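/- Consider American checkers (English draughts) generalized to an $n\times n$ board, for arbitrary $n$. A configuration is an arbitrary placement of black and red pieces, each a man or a king, on the dark squares. Men move and jump diagonally forward only, kings move and jump in all four diagonal directions. A jump passes over an adjacent opposing piece to the empty square directly behind it and removes that piece. Capturing is mandatory, and a capturing move must be continued as long as the moving piece can jump, except that it ends when a man reaches the last row and is crowned. A player wins by capturing all of the opponent's pieces. Lose-in-1 Checkers is the following decision problem. Given a configuration, written out square by square, with Black to move, does Black have a legal move after which Red must win on the next turn, that is, after which Red has at least one legal move and every legal move of Red captures all remaining black pieces? **Theorem.** Lose-in-1 Checkers is in $\mathrm{NP}$. -/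

import Mathlib

/-! ### Checkers on an `n × n` board -/

namespace Checkers

/-- The two players. -/
inductive Color
  | black
  | red
  deriving DecidableEq

instance : Fintype Color := ⟨{.black, .red}, fun c => by cases c <;> simp⟩

/-- A piece: its owner, and whether it is a king (otherwise it is a man). -/
structure Piece where
  color : Color
  king : Bool
  deriving DecidableEq, Fintype

/-- Squares of the `n × n` board, as pairs (row, column). Row `0` is Black's home row and row
`n - 1` is Red's home row. -/
abbrev Square (n : ℕ) := Fin n × Fin n

/-- The contents of every square; `none` is an empty square. -/
abbrev Board (n : ℕ) := Square n → Option Piece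

/-- A game configuration: pieces stand only on dark squares (the corner `(0, 0)` is dark). -/
def IsConfiguration {n : ℕ} (b : Board n) : Prop :=
  ∀ s : Square n, b s ≠ none → Even (s.1.val + s.2.val)

/-- The forward direction (change of row) of a player's men. -/
def Color.forward : Color → ℤ
  | .black => 1
  | .red => -1

/-- The last row on the opponent's side of the `n × n` board, where men are crowned. -/
def Color.IsLastRow (n : ℕ) (c : Color) (r : Fin n) : Prop :=
  match c with
  | .black => r.val + 1 = n
  | .red => r.val = 0

/-- The diagonal directions in which a piece may move or jump: all four for a king, the two forward
ones for a man. -/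
def Piece.MayGo (x : Piece) (d : ℤ × ℤ) : Prop :=
  (d.1 = 1 ∨ d.1 = -1) ∧ (d.2 = 1 ∨ d.2 = -1) ∧ (x.king = true ∨ d.1 = x.color.forward)

/-- `t` is the square reached from `s` by `k` diagonal steps in direction `d`. -/
def IsShift {n : ℕ} (s : Square n) (k : ℤ) (d : ℤ × ℤ) (t : Square n) : Prop :=
  (t.1.val : ℤ) = s.1.val + k * d.1 ∧ (t.2.val : ℤ) = s.2.val + k * d.2

/-- The piece `x` is crowned by arriving at `t`: it is a man and `t` is in its last row. -/
def Crowned {n : ℕ} (x : Piece) (t : Square n) : Prop :=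
  x.king = false ∧ x.color.IsLastRow n t.1

open Classical in
/-- The piece that stands on `t` once `x` has arrived there. -/
noncomputable def arrive {n : ℕ} (x : Piece) (t : Square n) : Piece :=
  if Crowned x t then ⟨x.color, true⟩ else x

/-- The piece `x` on `s` makes an ordinary (non-capturing) move, turning `b` into `b'`. -/
def Slide {n : ℕ} (b : Board n) (s : Square n) (x : Piece) (b' : Board n) : Prop :=
  b s = some x ∧ ∃ (d : ℤ × ℤ) (t : Square n), x.MayGo d ∧ IsShift s 1 d t ∧ b t = none ∧
    b' = Function.update (Function.update b s none) t (some (arrive x t))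

/-- The piece `x` on `s` makes one jump, landing on `t`, over an adjacent opposing piece, which is
removed; the board `b` turns into `b'`. -/
def Jump {n : ℕ} (b : Board n) (s : Square n) (x : Piece) (t : Square n) (b' : Board n) : Prop :=
  b s = some x ∧ ∃ (d : ℤ × ℤ) (m : Square n) (y : Piece), x.MayGo d ∧
    IsShift s 1 d m ∧ IsShift s 2 d t ∧ b m = some y ∧ y.color ≠ x.color ∧ b t = none ∧
    b' = Function.update (Function.update (Function.update b s none) m none) t
      (some (arrive x t))

/-- The piece on `s` can make a jump. -/
def CanJump {n : ℕ} (b : Board n) (s : Square n) : Prop :=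
  ∃ (x : Piece) (t : Square n) (b' : Board n), Jump b s x t b'

/-- A complete capturing move of the piece `x` on `s`, turning `b` into `b'`: a nonempty sequence of
jumps, which must be continued as long as the piece can jump, except that the move ends when a
man is crowned. -/
inductive CaptureMove {n : ℕ} : Board n → Square n → Piece → Board n → Prop
  | last {b : Board n} {s : Square n} {x : Piece} {t : Square n} {b' : Board n} :
      Jump b s x t b' → (Crowned x t ∨ ¬ CanJump b' t) → CaptureMove b s x b'
  | more {b : Board n} {s : Square n} {x : Piece} {t : Square n} {b₁ b' : Board n} :
      Jump b s x t b₁ → ¬ Crowned x t → CaptureMove b₁ t x b' → CaptureMove b s x b'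

/-- The legal moves of the player `c`: a complete capturing move of one piece, or, only if none of
the player's pieces can jump, an ordinary move of one piece. -/
def LegalMove {n : ℕ} (c : Color) (b b' : Board n) : Prop :=
  (∃ (s : Square n) (x : Piece), x.color = c ∧ CaptureMove b s x b') ∨
  ((∀ (s : Square n) (x : Piece), b s = some x → x.color = c → ¬ CanJump b s) ∧
    ∃ (s : Square n) (x : Piece), x.color = c ∧ Slide b s x b')

/-- The board carries no piece of the player `c` (so the opponent of `c` has won). -/
def NoPieces {n : ℕ} (c : Color) (b : Board n) : Prop :=
  ∀ (s : Square n) (x : Piece), b s = some x → x.color ≠ c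

/-- Black, to move, has a move after which Red must win on the next turn: Red has a legal move, and
every legal move of Red captures all remaining black pieces. -/
def LoseInOne {n : ℕ} (b : Board n) : Prop :=
  ∃ b₁ : Board n, LegalMove .black b b₁ ∧ (∃ b₂ : Board n, LegalMove .red b₁ b₂) ∧
    ∀ b₂ : Board n, LegalMove .red b₁ b₂ → NoPieces .black b₂

/-! ### The decision problem as a formal language -/

/-- The alphabet in which boards are written: the contents of a square, or an end-of-row mark. -/
inductive Symbol
  | cell (x : Option Piece)
  | endRow
  deriving DecidableEq, Fintype

/-- A board is written row by row, one symbol per square and an end-of-row mark after each row. -/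
def encodeBoard {n : ℕ} (b : Board n) : List Symbol :=
  (List.finRange n).flatMap fun i =>
    ((List.finRange n).map fun j => Symbol.cell (b (i, j))) ++ [Symbol.endRow]

/-- The decision problem: the encodings of the configurations, on boards of all sizes, with Black
to move, for which the answer is yes. -/
def loseInOneCheckers : Language Symbol :=
  {w | ∃ (n : ℕ) (b : Board n), IsConfiguration b ∧ LoseInOne b ∧ w = encodeBoard b}

end Checkers

/-! ### The complexity class NP -/

namespace Complexity

/-- The input of a verifier, a word and a binary certificate, as one string over the disjoint union
of the two alphabets. -/
def encodePair {A : Type} (p : List A × List Bool) : List (A ⊕ Bool) :=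
  p.1.map Sum.inl ++ p.2.map Sum.inr

/-- The class NP of languages over the alphabet `A`: membership of a word is witnessed by a
certificate of length polynomial in the length of the word, which is checked by a deterministic
(multi-stack) Turing machine in polynomial time. -/
def NP (A : Type) [Fintype A] : Set (Language A) :=
  {L | ∃ (verify : List A × List Bool → Bool) (p : Polynomial ℕ),
    Nonempty (Turing.TM2ComputableInPolyTime (encodePair (A := A)) Computability.encodeBool
      verify) ∧
    ∀ w : List A, w ∈ L ↔ ∃ c : List Bool, c.length ≤ p.eval w.length ∧ verify (w, c) = true}

end Complexity

/-!
The theorem has two ingredients: a way to see that a language is in NP without programming Turing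
machines for it, and a short certificate that Red must win.

**Existential second-order definability.** A language of words is in NP if membership of `w` means
that there are ternary relations `T` on the positions of `w` for which a fixed first-order formula
holds (`WordLogic.mem_NP_of_fml`). This is the easy half of Fagin's theorem. The certificate lists
the values of the relations, and the verifier evaluates the formula by nested loops over the
positions. It is written in a small language of structured programs for machines with several
stacks, whose programs are compiled to Mathlib's `Turing.TM2` with a bound on the running time
(`StackProgram.computableInPolyTime`). The relations also supply the coordinate system of the board:
the row and the column of each position, and residues modulo `4`. These are pinned down by local
first-order conditions (`Checkers.Format.represents`), after which first-order conditions on the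
squares of a board can be used (`Checkers.Def`).

**Certificates for the game.** Black's move is described by the boards and the squares between its
jumps (`Checkers.IsTrail`). A move consists of polynomially many jumps because each jump removes a
piece. If Red must win, Red must be able to capture, and then the certificate has to show that for
each red piece that can capture, every complete capturing move takes all black pieces. There may be
exponentially many such moves, but it is enough to describe one of them that takes all black pieces,
together with a little more.

* For a man nothing more is needed: it only moves forward, so a piece that it passes by stays on the
  board, and the existence of one capturing move that takes everything leaves it no choice
  (`Checkers.CaptureMove.eq_of_man`).
* The capturing moves of a king on `s` are trails in a graph. Its vertices are the squares that
  differ from `s` by a sum of vectors `(±2, ±2)`, and every black piece is an edge that joins the two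
  vertices diagonally next to it. Suppose that one trail from `s` uses all edges and ends on `t`.
  Then every maximal trail from `s` uses all edges if and only if each edge that avoids `t` is a
  bridge of the graph without the edges at `t`. Indeed, by parity of degrees each maximal trail ends
  on `t`, and the edges that it leaves over have even degrees and avoid `t`; such a set of edges
  cannot meet a cut in exactly one edge (`Checkers.enemies_eq_empty_of_isBridgeCut`). Conversely, an
  edge `e` that is not the only edge of a cut lies in a set of edges with even degrees, by linear
  duality over the field with two elements, and a king that avoids this set gets stuck on `t` with
  some pieces left (`Checkers.exists_isBridgeCut`). So the certificate contains a cut for each such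
  edge.
-/

/-! ### Structured programs on stacks -/

namespace StackProgram

open Turing

/-- Structured programs that act on finitely many stacks over one alphabet `Γ`, indexed by `K`, and
on a single Boolean flag. -/
inductive Prog (K Γ : Type) : Type
  /-- Move the top of stack `i`, if there is one, to stack `j`. -/
  | move (i j : K)
  /-- Remove the top of stack `i`, if there is one. -/
  | drop (i : K)
  /-- Push the letter `a` on stack `i`. -/
  | push (i : K) (a : Γ)
  /-- Update the flag in dependence on the top of stack `i`. -/
  | look (i : K) (f : Bool → Option Γ → Bool)
  /-- Sequential composition. -/
  | seq (p q : Prog K Γ)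
  /-- Run `p` if the flag is set, and `q` otherwise. -/
  | ite (p q : Prog K Γ)
  /-- Repeat `p` as long as stack `i` is nonempty. -/
  | whl (i : K) (p : Prog K Γ)

variable {K Γ : Type} [DecidableEq K]

open Function (update)

/-- `Runs p f S f' S' t`: started with flag `f` and stacks `S`, the program `p` ends with flag `f'`
and stacks `S'`, and the machine it is compiled to makes exactly `t` steps. -/
inductive Runs : Prog K Γ → Bool → (K → List Γ) → Bool → (K → List Γ) → ℕ → Prop
  | move_nil {i j f S} : S i = [] → Runs (.move i j) f S f S 1
  | move_cons {i j f S a l} : S i = a :: l →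
      Runs (.move i j) f S f (update (update S i l) j (a :: update S i l j)) 1
  | drop {i f S} : Runs (.drop i) f S f (update S i (S i).tail) 1
  | push {i a f S} : Runs (.push i a) f S f (update S i (a :: S i)) 1
  | look {i g f S} : Runs (.look i g) f S (g f (S i).head?) S 1
  | seq {p q f S f₁ S₁ f₂ S₂ t₁ t₂} : Runs p f S f₁ S₁ t₁ → Runs q f₁ S₁ f₂ S₂ t₂ →
      Runs (.seq p q) f S f₂ S₂ (t₁ + t₂)
  | ite_true {p q S f₁ S₁ t} : Runs p true S f₁ S₁ t → Runs (.ite p q) true S f₁ S₁ (1 + t)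
  | ite_false {p q S f₁ S₁ t} : Runs q false S f₁ S₁ t → Runs (.ite p q) false S f₁ S₁ (1 + t)
  | whl_done {i p f S} : S i = [] → Runs (.whl i p) f S f S 1
  | whl_step {i p f S f₁ S₁ f₂ S₂ t₁ t₂} : S i ≠ [] → Runs p f S f₁ S₁ t₁ →
      Runs (.whl i p) f₁ S₁ f₂ S₂ t₂ → Runs (.whl i p) f S f₂ S₂ (1 + t₁ + t₂)

/-! ### Compilation to Turing machines -/

/-- The labels of the machine code of a program. -/
def Prog.Lab : Prog K Γ → Type
  | .move _ _ | .drop _ | .push _ _ | .look _ _ => Unit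
  | .seq p q => p.Lab ⊕ q.Lab
  | .ite p q => Option (p.Lab ⊕ q.Lab)
  | .whl _ p => Option p.Lab

noncomputable instance Prog.fintypeLab : (p : Prog K Γ) → Fintype p.Lab
  | .move _ _ | .drop _ | .push _ _ | .look _ _ => inferInstanceAs (Fintype Unit)
  | .seq p q =>
    letI := p.fintypeLab
    letI := q.fintypeLab
    inferInstanceAs (Fintype (p.Lab ⊕ q.Lab))
  | .ite p q =>
    letI := p.fintypeLab
    letI := q.fintypeLab
    inferInstanceAs (Fintype (Option (p.Lab ⊕ q.Lab)))
  | .whl _ p =>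
    letI := p.fintypeLab
    inferInstanceAs (Fintype (Option p.Lab))

/-- The label at which the code of a program is entered. -/
def Prog.entry : (p : Prog K Γ) → p.Lab
  | .move _ _ | .drop _ | .push _ _ | .look _ _ => ()
  | .seq p _ => Sum.inl p.entry
  | .ite _ _ => none
  | .whl _ _ => none

/-- The stack alphabets of the compiled machine: the stacks of the program and one output stack. -/
abbrev Alph (K Γ : Type) : Option K → Type
  | none => Bool
  | some _ => Γ

/-- The internal memory of the compiled machine: the flag and a letter that has just been read. -/
abbrev Mem (Γ : Type) : Type := Bool × Option Γ

/-- The code of a program inside a machine with labels `Λ`, into which the labels of the program are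
embedded by `emb`; on completion the code jumps to `exit`. -/
def Prog.code [Inhabited Γ] {Λ : Type} : (p : Prog K Γ) → (p.Lab → Λ) → Λ → p.Lab →
    TM2.Stmt (Alph K Γ) Λ (Mem Γ)
  | .move i j, _, exit, _ =>
    .pop (some i) (fun v o => (v.1, o)) <|
      .branch (fun v => v.2.isSome)
        (.push (some j) (fun v => v.2.getD default) <| .load (fun v => (v.1, none)) <|
          .goto fun _ => exit)
        (.goto fun _ => exit)
  | .drop i, _, exit, _ => .pop (some i) (fun v _ => v) <| .goto fun _ => exit
  | .push i a, _, exit, _ => .push (some i) (fun _ => a) <| .goto fun _ => exit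
  | .look i f, _, exit, _ => .peek (some i) (fun v o => (f v.1 o, none)) <| .goto fun _ => exit
  | .seq p q, emb, exit, l =>
    match l with
    | .inl l => p.code (fun x => emb (.inl x)) (emb (.inr q.entry)) l
    | .inr l => q.code (fun x => emb (.inr x)) exit l
  | .ite p q, emb, exit, l =>
    match l with
    | none => .goto fun v => bif v.1 then emb (some (.inl p.entry)) else emb (some (.inr q.entry))
    | some (.inl l) => p.code (fun x => emb (some (.inl x))) exit l
    | some (.inr l) => q.code (fun x => emb (some (.inr x))) exit l
  | .whl i p, emb, exit, l =>
    match l with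
    | none =>
      .peek (some i) (fun v o => (v.1, o)) <|
        .branch (fun v => v.2.isSome)
          (.load (fun v => (v.1, none)) <| .goto fun _ => emb (some p.entry))
          (.goto fun _ => exit)
    | some l => p.code (fun x => emb (some x)) (emb none) l

/-- The contents of all stacks of the compiled machine, with an empty output stack. -/
def extend (S : K → List Γ) : (k : Option K) → List (Alph K Γ k)
  | none => []
  | some k => S k

omit [DecidableEq K] in
@[simp] theorem extend_some (S : K → List Γ) (k : K) : extend S (some k) = S k := rfl

@[simp] theorem update_extend (S : K → List Γ) (k : K) (l : List Γ) :
    update (extend S) (some k) l = extend (update S k l) := by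
  funext j
  rcases j with _ | j
  · rfl
  · by_cases h : j = k
    · subst h; simp
    · simp [h]

variable {Λ : Type}

/-- The machine `m` gets from `c` to `c'` in `t` steps. -/
def Steps (m : Λ → TM2.Stmt (Alph K Γ) Λ (Mem Γ)) (t : ℕ)
    (c c' : TM2.Cfg (Alph K Γ) Λ (Mem Γ)) : Prop :=
  (flip bind (TM2.step m))^[t] (some c) = some c'

theorem Steps.trans {m : Λ → TM2.Stmt (Alph K Γ) Λ (Mem Γ)} {t₁ t₂ : ℕ}
    {c₁ c₂ c₃ : TM2.Cfg (Alph K Γ) Λ (Mem Γ)} (h₁ : Steps m t₁ c₁ c₂) (h₂ : Steps m t₂ c₂ c₃) :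
    Steps m (t₁ + t₂) c₁ c₃ := by
  unfold Steps at *
  rw [Nat.add_comm, Function.iterate_add_apply, h₁, h₂]

theorem Steps.one {m : Λ → TM2.Stmt (Alph K Γ) Λ (Mem Γ)} {l : Λ} {v : Mem Γ}
    {S : (k : Option K) → List (Alph K Γ k)} {c : TM2.Cfg (Alph K Γ) Λ (Mem Γ)}
    (h : TM2.stepAux (m l) v S = c) : Steps m 1 ⟨some l, v, S⟩ c := by
  simp [Steps, flip, h]

/-- The compiled code behaves as the program. -/
theorem Runs.steps [Inhabited Γ] {p : Prog K Γ} {f f' : Bool} {S S' : K → List Γ} {t : ℕ}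
    (h : Runs p f S f' S' t) (m : Λ → TM2.Stmt (Alph K Γ) Λ (Mem Γ)) (emb : p.Lab → Λ) (exit : Λ)
    (hm : ∀ l, m (emb l) = p.code emb exit l) :
    Steps m t ⟨some (emb p.entry), (f, none), extend S⟩ ⟨some exit, (f', none), extend S'⟩ := by
  induction h generalizing exit with
  | @move_nil i _ _ S h =>
    have : update S i [] = S := by rw [← h, Function.update_eq_self]
    exact Steps.one (by simp [hm, Prog.code, h, this])
  | move_cons h => exact Steps.one (by simp [hm, Prog.code, h])
  | drop => exact Steps.one (by simp [hm, Prog.code])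
  | push => exact Steps.one (by simp [hm, Prog.code])
  | look => exact Steps.one (by simp [hm, Prog.code])
  | seq _ _ ih₁ ih₂ =>
    exact (ih₁ (fun x => emb (.inl x)) _ fun l => hm (.inl l)).trans
      (ih₂ (fun x => emb (.inr x)) exit fun l => hm (.inr l))
  | ite_true _ ih =>
    refine Steps.trans (Steps.one ?_) (ih (fun x => emb (some (.inl x))) exit fun l => hm _)
    rw [hm]; simp [Prog.entry, Prog.code]
  | ite_false _ ih =>
    refine Steps.trans (Steps.one ?_) (ih (fun x => emb (some (.inr x))) exit fun l => hm _)
    rw [hm]; simp [Prog.entry, Prog.code]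
  | whl_done h => exact Steps.one (by rw [hm]; simp [Prog.entry, Prog.code, h])
  | @whl_step i p f S f₁ S₁ f₂ S₂ t₁ t₂ h _ _ ih₁ ih₂ =>
    refine Steps.trans (Steps.trans (Steps.one ?_)
      (ih₁ (fun x => emb (some x)) (emb none) fun l => hm _)) (ih₂ emb exit hm)
    obtain ⟨a, l, hl⟩ := List.exists_cons_of_ne_nil h
    rw [hm]; simp [Prog.entry, Prog.code, hl]

/-- The machine that runs a program and then writes the flag on the output stack. -/
noncomputable def machine [Fintype K] [Inhabited Γ] [Fintype Γ] (p : Prog K Γ) (inp : K) :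
    FinTM2 where
  K := Option K
  k₀ := some inp
  k₁ := none
  Γ := Alph K Γ
  Λ := Option p.Lab
  main := some p.entry
  σ := Mem Γ
  initialState := (false, none)
  Γk₀Fin := inferInstanceAs (Fintype Γ)
  m
    | some l => p.code some none l
    | none => .push none (fun v => v.1) <| .load (fun _ => (false, none)) <| .halt

/-- A function that is computed by a stack program, which leaves the result in the flag and all
stacks empty, within a polynomial number of steps, is computable in polynomial time. -/
theorem computableInPolyTime [Fintype K] [Inhabited Γ] [Fintype Γ] {α : Type} {ea : α → List Γ}
    {g : α → Bool} (p : Prog K Γ) (inp : K) (q : Polynomial ℕ)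
    (h : ∀ a, ∃ t ≤ q.eval (ea a).length,
      Runs p false (update (fun _ => []) inp (ea a)) (g a) (fun _ => []) t) :
    Nonempty (TM2ComputableInPolyTime ea Computability.encodeBool g) := by
  refine ⟨⟨⟨machine p inp, Equiv.refl _, Equiv.refl _⟩, q + 1, fun a => Classical.choice ?_⟩⟩
  obtain ⟨t, ht, hr⟩ := h a
  have h₁ := hr.steps (machine p inp).m some none fun _ => rfl
  have h₂ : Steps (machine p inp).m 1 ⟨some none, (g a, none), extend fun _ => []⟩
      ⟨none, (false, none), update (extend fun _ => []) none [g a]⟩ :=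
    Steps.one (by simp [machine]; rfl)
  have h₃ := h₁.trans h₂
  refine ⟨⟨⟨t + 1, ?_⟩, by simpa using ht⟩⟩
  have e₁ : initList (machine p inp) (List.map (Equiv.refl _).invFun (ea a)) =
      ⟨some (some p.entry), (false, none), extend (update (fun _ => []) inp (ea a))⟩ := by
    unfold initList
    congr 1
    funext k
    by_cases hk : k = some inp
    · subst hk
      simp [machine]
      rfl
    · rcases k with _ | k
      · simp [machine, extend]
      · simp [machine, Function.update_of_ne (fun h => hk (congrArg some h))]
        exact fun h => absurd (congrArg some h) hk
  have e₂ : haltList (machine p inp) (List.map (Equiv.refl _).invFun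
      (Computability.encodeBool (g a))) =
      ⟨none, (false, none), update (extend fun _ => []) none [g a]⟩ := by
    unfold haltList
    congr 1
    funext k
    rcases k with _ | k
    · simp [machine]; rfl
    · simp [machine]
      rfl
  exact (congrArg _ (congrArg some e₁)).trans (Eq.trans h₃ (congrArg some e₂.symm))

end StackProgram

/-! ### Program constructs with time bounds -/

namespace StackProgram

open Function (update)

variable {K Γ : Type} [DecidableEq K]

/-- The program `p` leads from flag `f` and stacks `S` to flag `f'` and stacks `S'` in at most `b`
steps. -/
def RunsIn (p : Prog K Γ) (f : Bool) (S : K → List Γ) (f' : Bool) (S' : K → List Γ) (b : ℕ) :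
    Prop :=
  ∃ t ≤ b, Runs p f S f' S' t

theorem Runs.runsIn {p : Prog K Γ} {f f' : Bool} {S S' : K → List Γ} {t : ℕ}
    (h : Runs p f S f' S' t) : RunsIn p f S f' S' t :=
  ⟨t, le_rfl, h⟩

theorem RunsIn.mono {p : Prog K Γ} {f f' : Bool} {S S' : K → List Γ} {b b' : ℕ}
    (h : RunsIn p f S f' S' b) (hb : b ≤ b') : RunsIn p f S f' S' b' :=
  let ⟨t, ht, hr⟩ := h
  ⟨t, ht.trans hb, hr⟩

theorem RunsIn.to {p : Prog K Γ} {f f' : Bool} {S S' S'' : K → List Γ} {b b' : ℕ}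
    (h : RunsIn p f S f' S' b) (hS : S' = S'') (hb : b ≤ b') : RunsIn p f S f' S'' b' :=
  hS ▸ h.mono hb

theorem runsIn_move {i j : K} {f : Bool} {S : K → List Γ} {a : Γ} {l : List Γ}
    (h : S i = a :: l) (hij : i ≠ j) :
    RunsIn (.move i j) f S f (update (update S i l) j (a :: S j)) 1 :=
  (Runs.move_cons h).runsIn.to (by rw [Function.update_of_ne hij.symm]) le_rfl

theorem runsIn_move_nil {i j : K} {f : Bool} {S : K → List Γ} (h : S i = []) :
    RunsIn (.move i j) f S f S 1 :=
  (Runs.move_nil h).runsIn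

theorem RunsIn.seq {p q : Prog K Γ} {f f₁ f₂ : Bool} {S S₁ S₂ : K → List Γ} {b₁ b₂ : ℕ}
    (h₁ : RunsIn p f S f₁ S₁ b₁) (h₂ : RunsIn q f₁ S₁ f₂ S₂ b₂) :
    RunsIn (.seq p q) f S f₂ S₂ (b₁ + b₂) :=
  let ⟨t₁, ht₁, hr₁⟩ := h₁
  let ⟨t₂, ht₂, hr₂⟩ := h₂
  ⟨t₁ + t₂, by omega, hr₁.seq hr₂⟩

theorem RunsIn.ite {p q : Prog K Γ} {f f' : Bool} {S S' : K → List Γ} {b₁ b₂ : ℕ}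
    (h₁ : f = true → RunsIn p true S f' S' b₁) (h₂ : f = false → RunsIn q false S f' S' b₂) :
    RunsIn (.ite p q) f S f' S' (1 + b₁ + b₂) := by
  cases f
  · obtain ⟨t, ht, hr⟩ := h₂ rfl
    exact ⟨1 + t, by omega, .ite_false hr⟩
  · obtain ⟨t, ht, hr⟩ := h₁ rfl
    exact ⟨1 + t, by omega, .ite_true hr⟩

/-- A loop that runs `m` times, with states `F x`, `T x` after `x` rounds. -/
theorem RunsIn.whl {i : K} {p : Prog K Γ} {b : ℕ} (m : ℕ) (F : ℕ → Bool) (T : ℕ → K → List Γ)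
    (hne : ∀ x < m, T x i ≠ []) (hend : T m i = [])
    (hstep : ∀ x < m, RunsIn p (F x) (T x) (F (x + 1)) (T (x + 1)) b) :
    RunsIn (.whl i p) (F 0) (T 0) (F m) (T m) (m * (b + 1) + 1) := by
  induction m generalizing F T with
  | zero => exact ⟨1, by omega, .whl_done hend⟩
  | succ m ih =>
    obtain ⟨t₁, ht₁, hr₁⟩ := hstep 0 (by omega)
    obtain ⟨t₂, ht₂, hr₂⟩ := ih (fun x => F (x + 1)) (fun x => T (x + 1))
      (fun x hx => hne _ (by omega)) hend (fun x hx => hstep _ (by omega))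
    refine ⟨1 + t₁ + t₂, ?_, .whl_step (hne 0 (by omega)) hr₁ hr₂⟩
    rw [Nat.succ_mul]
    omega

theorem runsIn_look {i : K} {g : Bool → Option Γ → Bool} {f f' : Bool} {S : K → List Γ}
    (h : g f (S i).head? = f') : RunsIn (.look i g) f S f' S 1 :=
  h ▸ Runs.look.runsIn

/-- Skip: a program that changes nothing. -/
def Prog.skip (i : K) : Prog K Γ := .look i fun f _ => f

theorem runsIn_skip (i : K) (f : Bool) (S : K → List Γ) : RunsIn (.skip i) f S f S 1 :=
  Runs.look.runsIn

/-- Move the whole of stack `i` to stack `j`, which reverses it. -/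
def Prog.pour (i j : K) : Prog K Γ := .whl i (.move i j)

theorem runsIn_pour {i j : K} (hij : i ≠ j) (f : Bool) (S : K → List Γ) :
    RunsIn (.pour i j) f S f (update (update S i []) j ((S i).reverse ++ S j))
      ((S i).length * 2 + 1) := by
  have h := RunsIn.whl (i := i) (p := .move i j) (b := 1) (S i).length (fun _ => f)
    (fun x => update (update S i ((S i).drop x)) j (((S i).take x).reverse ++ S j))
    (fun x hx => by simp [Function.update_of_ne hij, hx])
    (by simp [Function.update_of_ne hij])
    (fun x hx => by
      refine (runsIn_move (a := (S i)[x]) (l := (S i).drop (x + 1)) ?_ hij).to ?_ le_rfl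
      · simp [Function.update_of_ne hij]
      · funext k
        by_cases hk : k = j
        · subst hk
          simp [List.take_succ_eq_append_getElem hx, -List.take_append_getElem]
        · by_cases hk' : k = i
          · subst hk'; simp [hk]
          · simp [hk, hk'])
  simpa [Prog.pour] using h

/-- Empty stack `i`. -/
def Prog.clear (i : K) : Prog K Γ := .whl i (.drop i)

theorem runsIn_clear (i : K) (f : Bool) (S : K → List Γ) :
    RunsIn (.clear i) f S f (update S i []) ((S i).length * 2 + 1) := by
  have h := RunsIn.whl (i := i) (p := .drop i) (b := 1) (S i).length (fun _ => f)
    (fun x => update S i ((S i).drop x))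
    (fun x hx => by simp [hx]) (by simp)
    (fun x hx => Runs.drop.runsIn.to (by simp) le_rfl)
  simpa [Prog.clear] using h

/-- Empty all stacks in the list `l`. -/
def Prog.clearAll (i : K) : List K → Prog K Γ
  | [] => .skip i
  | k :: l => .seq (.clear k) (.clearAll i l)

theorem runsIn_clearAll (i : K) (l : List K) (f : Bool) (S : K → List Γ) (B : ℕ)
    (hB : ∀ k, (S k).length ≤ B) :
    RunsIn (.clearAll i l) f S f (fun k => if k ∈ l then [] else S k)
      (l.length * (B * 2 + 1) + 1) := by
  induction l generalizing S with
  | nil => exact (runsIn_skip i f S).to (by simp) (by simp)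
  | cons k l ih =>
    have h := ih (update S k []) fun j => by
      by_cases hj : j = k
      · subst hj; simp
      · simpa [hj] using hB j
    refine ((runsIn_clear k f S).seq h).to ?_ ?_
    · funext j
      by_cases hj : j = k
      · subst hj; simp
      · simp [hj]
    · have := hB k
      simp only [List.length_cons, Nat.succ_mul]
      omega

/-- Push the letter `u` on all stacks in the list `l`. -/
def Prog.pushAll (i : K) (u : Γ) : List K → Prog K Γ
  | [] => .skip i
  | k :: l => .seq (.push k u) (.pushAll i u l)

theorem runsIn_pushAll (i : K) (u : Γ) (l : List K) (f : Bool) (S : K → List Γ) :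
    RunsIn (.pushAll i u l) f S f (fun k => List.replicate (l.count k) u ++ S k)
      (l.length + 1) := by
  induction l generalizing S with
  | nil => exact (runsIn_skip i f S).to (by simp) (by simp)
  | cons k l ih =>
    refine (Runs.push.runsIn.seq (ih _)).to ?_ (by simp; omega)
    funext j
    by_cases hj : j = k
    · subst hj; simp [List.replicate_succ']
    · simp [hj, Ne.symm hj]

/-- Run `p` once for every element of stack `i`, using stack `j` to restore stack `i`. -/
def Prog.for (i j : K) (p : Prog K Γ) : Prog K Γ :=
  .seq (.whl i (.seq p (.move i j))) (.pour j i)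

/-- Move `m` letters from stack `i` to stack `j`. -/
def advance (i j : K) (m : ℕ) (S : K → List Γ) : K → List Γ :=
  update (update S i ((S i).drop m)) j (((S i).take m).reverse ++ S j)

theorem advance_of_ne {i j k : K} (hi : k ≠ i) (hj : k ≠ j) (m : ℕ) (S : K → List Γ) :
    advance i j m S k = S k := by
  simp [advance, hi, hj]

theorem advance_zero (i j : K) (S : K → List Γ) : advance i j 0 S = S := by
  simp [advance]

theorem advance_add {i j : K} (hij : i ≠ j) (m m' : ℕ) (S : K → List Γ) :
    advance i j (m + m') S = advance i j m' (advance i j m S) := by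
  funext k
  by_cases hk : k = j
  · subst hk
    simp [advance, Function.update_of_ne hij, List.take_add]
  · by_cases hk' : k = i
    · subst hk'; simp [advance, hk]
    · simp [advance, hk, hk']

theorem advance_update {i j k : K} (hi : k ≠ i) (hj : k ≠ j) (m : ℕ) (S : K → List Γ)
    (l : List Γ) : advance i j m (update S k l) = update (advance i j m S) k l := by
  funext x
  by_cases hx : x = k
  · subst hx; simp [advance, hi, hj]
  · by_cases hx' : x = j
    · subst hx'; simp [advance, hi.symm, hj.symm]
    · by_cases hx'' : x = i
      · subst hx''; simp [advance, hx, hx']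
      · simp [advance, hx, hx', hx'']

/-- Within `b` steps the program `p` moves `m` letters from stack `i` to stack `j`, whenever the
stacks in `Z` have the same contents as in `S₀`. -/
def Skips (i j : K) (S₀ : K → List Γ) (p : Prog K Γ) (m : ℕ) (Z : Set K) (b : ℕ) : Prop :=
  ∀ f S, (∀ k ∈ Z, S k = S₀ k) → RunsIn p f S f (advance i j m S) b

section Skips

variable {i j : K} {S₀ : K → List Γ}

theorem Skips.move (hij : i ≠ j) : Skips i j S₀ (.move i j) 1 ∅ 1 := by
  intro f S _
  rcases hS : S i with _ | ⟨a, l⟩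
  · have : update S i [] = S := by rw [← hS, Function.update_eq_self]
    exact (runsIn_move_nil hS).to (by simp [advance, hS, this]) le_rfl
  · exact (runsIn_move hS hij).to (by simp [advance, hS]) le_rfl

theorem Skips.skip (k : K) : Skips i j S₀ (.skip k) 0 ∅ 1 := by
  intro f S _
  rw [advance_zero]
  exact runsIn_skip k f S

theorem Skips.seq (hij : i ≠ j) {p q : Prog K Γ} {m m' b b' : ℕ} {Z : Set K}
    (hp : Skips i j S₀ p m Z b) (hq : Skips i j S₀ q m' Z b') (hi : i ∉ Z) (hj : j ∉ Z) :
    Skips i j S₀ (.seq p q) (m + m') Z (b + b') := by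
  intro f S hS
  rw [advance_add hij]
  refine (hp f S hS).seq (hq f _ fun k hk => ?_)
  rw [advance_of_ne (ne_of_mem_of_not_mem hk hi) (ne_of_mem_of_not_mem hk hj), hS k hk]

theorem Skips.mono {p : Prog K Γ} {m b b' : ℕ} {Z Z' : Set K} (hp : Skips i j S₀ p m Z b)
    (hZ : Z ⊆ Z') (hb : b ≤ b') : Skips i j S₀ p m Z' b' :=
  fun f S hS => (hp f S fun k hk => hS k (hZ hk)).mono hb

/-- A counted loop around a program that skips `m` letters, with the counter `k`, whose elements are
kept on `k'` during the loop. -/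
theorem Skips.for (hij : i ≠ j) {p : Prog K Γ} {m b x B : ℕ} {Z : Set K} {k k' : K} {u : Γ}
    (hp : Skips i j S₀ p m Z b) (hi : i ∉ Z) (hj : j ∉ Z) (hk : k ∉ Z) (hk' : k' ∉ Z)
    (hkk : k ≠ k') (hki : k ≠ i) (hkj : k ≠ j) (hki' : k' ≠ i) (hkj' : k' ≠ j)
    (hx : S₀ k = List.replicate x u) (hx' : S₀ k' = []) (hB : x ≤ B) :
    Skips i j S₀ (.for k k' p) (x * m) (insert k (insert k' Z)) (B * (b + 4) + 2) := by
  intro f S hS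
  have hSk : S k = List.replicate x u := by rw [hS k (by simp), hx]
  have hSk' : S k' = [] := by rw [hS k' (by simp), hx']
  have h₁ := RunsIn.whl (i := k) (p := .seq p (.move k k')) (b := b + 1) x (fun _ => f)
    (fun r => update (update (advance i j (r * m) S) k (List.replicate (x - r) u)) k'
      (List.replicate r u))
    (fun r hr => by simp [Function.update_of_ne hkk]; omega)
    (by simp [Function.update_of_ne hkk])
    (fun r hr => by
      refine (hp f _ fun z hz => ?_).seq ?_
      · have h1 : z ≠ k := fun h => hk (h ▸ hz)
        have h2 : z ≠ k' := fun h => hk' (h ▸ hz)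
        have h3 : z ≠ i := fun h => hi (h ▸ hz)
        have h4 : z ≠ j := fun h => hj (h ▸ hz)
        simp [ne_of_mem_of_not_mem hz hk, ne_of_mem_of_not_mem hz hk',
          advance_of_ne (ne_of_mem_of_not_mem hz hi) (ne_of_mem_of_not_mem hz hj),
          hS z (by simp [hz])]
      · have e : x - r = (x - (r + 1)) + 1 := by omega
        refine (runsIn_move (a := u) (l := List.replicate (x - (r + 1)) u) ?_ hkk).to ?_ le_rfl
        · rw [advance_update hki' hkj', advance_update hki hkj]
          simp [Function.update_of_ne hkk, e, List.replicate_succ]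
        · rw [advance_update hki' hkj', advance_update hki hkj, Nat.succ_mul, advance_add hij]
          funext z
          by_cases hz : z = k'
          · subst hz; simp [List.replicate_succ]
          · by_cases hz' : z = k
            · subst hz'; simp [hz]
            · simp [hz, hz'])
  have h₂ := runsIn_pour (i := k') (j := k) hkk.symm f
    (update (update (advance i j (x * m) S) k (List.replicate (x - x) u)) k'
      (List.replicate x u))
  have h₀ : update (update (advance i j (0 * m) S) k (List.replicate (x - 0) u)) k'
      (List.replicate 0 u) = S := by
    rw [Nat.zero_mul, advance_zero, Nat.sub_zero, ← hSk, List.replicate_zero, ← hSk']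
    simp
  rw [h₀] at h₁
  refine (h₁.seq h₂).to ?_ ?_
  · funext z
    by_cases hz : z = k
    · subst hz; simp [advance_of_ne hki hkj, hSk, Function.update_of_ne hkk]
    · by_cases hz' : z = k'
      · subst hz'; simp [advance_of_ne hki' hkj', hSk', hz]
      · simp [hz, hz']
  · simp only [Function.update_self, List.length_replicate]
    have : x * (b + 4) ≤ B * (b + 4) := Nat.mul_le_mul_right _ hB
    nlinarith

/-- A constant number of repetitions of a program. -/
def Prog.rep (k : K) (p : Prog K Γ) : ℕ → Prog K Γ
  | 0 => .skip k
  | n + 1 => .seq (.rep k p n) p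

theorem Skips.rep (hij : i ≠ j) {p : Prog K Γ} {m b : ℕ} {Z : Set K} (k : K)
    (hp : Skips i j S₀ p m Z b) (hi : i ∉ Z) (hj : j ∉ Z) (n : ℕ) :
    Skips i j S₀ (.rep k p n) (n * m) Z (n * b + 1) := by
  induction n with
  | zero =>
    rw [Nat.zero_mul, Nat.zero_mul]
    exact (Skips.skip k).mono (Set.empty_subset Z) le_rfl
  | succ n ih =>
    rw [Nat.succ_mul]
    exact (ih.seq hij hp hi hj).mono subset_rfl (by rw [Nat.succ_mul]; omega)

end Skips

end StackProgram

/-! ### First-order formulas over words with ternary relations -/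

namespace WordLogic

/-- First-order formulas, with free variables `0, …, d - 1`, over a word in the alphabet `A` and a
family of ternary relations indexed by `J`. The variables range over the positions in the word. A
quantifier binds the first variable that is not free. -/
inductive Fml (A J : Type) : ℕ → Type
  | verum {d : ℕ} : Fml A J d
  | lt {d : ℕ} (i j : Fin d) : Fml A J d
  | letter {d : ℕ} (f : A → Bool) (i : Fin d) : Fml A J d
  | rel {d : ℕ} (j : J) (x y z : Fin d) : Fml A J d
  | not {d : ℕ} (φ : Fml A J d) : Fml A J d
  | and {d : ℕ} (φ ψ : Fml A J d) : Fml A J d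
  | all {d : ℕ} (φ : Fml A J (d + 1)) : Fml A J d

/-- Families of ternary relations. -/
abbrev Rels (J : Type) : Type := J → ℕ → ℕ → ℕ → Bool

variable {A J : Type}

/-- The truth of a formula. -/
def Fml.Holds (w : List A) (T : Rels J) : {d : ℕ} → Fml A J d → (Fin d → ℕ) → Prop
  | _, .verum, _ => True
  | _, .lt i j, v => v i < v j
  | _, .letter f i, v => ∃ a, w[v i]? = some a ∧ f a = true
  | _, .rel j x y z, v => T j (v x) (v y) (v z) = true
  | _, .not φ, v => ¬ φ.Holds w T v
  | _, .and φ ψ, v => φ.Holds w T v ∧ ψ.Holds w T v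
  | _, .all φ, v => ∀ x < w.length, φ.Holds w T (Fin.snoc v x)

/-- The quantifier depth of a formula. -/
def Fml.depth : {d : ℕ} → Fml A J d → ℕ
  | _, .verum | _, .lt _ _ | _, .letter _ _ | _, .rel _ _ _ _ => 0
  | _, .not φ => φ.depth
  | _, .and φ ψ => max φ.depth ψ.depth
  | _, .all φ => φ.depth + 1

/-- Substitution of variables for variables. -/
def Fml.rename : {d e : ℕ} → Fml A J d → (Fin d → Fin e) → Fml A J e
  | _, _, .verum, _ => .verum
  | _, _, .lt i j, g => .lt (g i) (g j)
  | _, _, .letter f i, g => .letter f (g i)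
  | _, _, .rel j x y z, g => .rel j (g x) (g y) (g z)
  | _, _, .not φ, g => .not (φ.rename g)
  | _, _, .and φ ψ, g => .and (φ.rename g) (ψ.rename g)
  | _, e, .all φ, g => .all (φ.rename (Fin.snoc (fun i => (g i).castSucc) (Fin.last e)))

theorem Fml.holds_rename (w : List A) (T : Rels J) {d e : ℕ} (φ : Fml A J d) (g : Fin d → Fin e)
    (v : Fin e → ℕ) : (φ.rename g).Holds w T v ↔ φ.Holds w T (fun i => v (g i)) := by
  induction φ generalizing e with
  | verum | lt | letter | rel => rfl
  | not φ ih => exact not_congr (ih g v)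
  | and φ ψ ih₁ ih₂ => exact and_congr (ih₁ g v) (ih₂ g v)
  | all φ ih =>
    refine forall₂_congr fun x _ => (ih _ _).trans (iff_of_eq (congrArg _ ?_))
    funext i
    refine Fin.lastCases ?_ (fun i => ?_) i <;> simp

/-! ### Evaluation of formulas by programs -/

/-- The stacks that are used for the evaluation of formulas: the input, an auxiliary stack that
receives the part of the input that has been read, three counters that hold as many elements as the
word has letters, and for every level `l` of nested quantifiers a variable, whose value is the number
of elements on `var l` while `rem l` holds the rest. The other stacks are used to restore these. -/
inductive Stk (D : ℕ)
  | inp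
  | aux
  | cnt (i : Fin 3)
  | cntS (i : Fin 3)
  | rem (l : Fin (D + 1))
  | var (l : Fin (D + 1))
  | varS (l : Fin (D + 1))
  deriving DecidableEq, Fintype

open StackProgram

/-- The level of the variable `i`. The value is meaningful only for `i ≤ D`. -/
def lev (D i : ℕ) : Fin (D + 1) := Fin.ofNat (D + 1) i

instance : Inhabited (A ⊕ Bool) := ⟨.inr true⟩

/-- The letter that is used for counting. -/
abbrev unit : A ⊕ Bool := .inr true

/-- Skip `N ^ r` input letters, where `N` is the length of the word; the counters from `i` on are
used. -/
def skipPow (D : ℕ) : ℕ → Prog (Stk D) (A ⊕ Bool)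
  | 0 => .move .inp .aux
  | r + 1 => .for (.cnt (Fin.ofNat 3 r)) (.cntS (Fin.ofNat 3 r)) (skipPow D r)

/-- Skip `x * N ^ r` input letters, where `x` is the value of a variable. -/
def skipVar (D : ℕ) (i r : ℕ) : Prog (Stk D) (A ⊕ Bool) :=
  .for (.var (lev D i)) (.varS (lev D i)) (skipPow D r)

/-- Put back the part of the input that has been read. -/
def rewind (D : ℕ) : Prog (Stk D) (A ⊕ Bool) := .pour .aux .inp

/-- Set the flag if the variable on level `p` has a smaller value than the variable on level `q`. -/
def compare {D : ℕ} (p q : Fin (D + 1)) : Prog (Stk D) (A ⊕ Bool) :=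
  if p = q then .look .inp fun _ _ => false else
    .seq (.whl (.var p) (.seq (.move (.var p) (.varS p)) (.move (.var q) (.varS q)))) <|
    .seq (.look (.var q) fun _ o => o.isSome) <|
    .seq (.pour (.varS p) (.var p)) (.pour (.varS q) (.var q))

/-- Set the flag if the letter at position `i` of the word satisfies `f`. -/
def letterProg (D : ℕ) (f : A → Bool) (i : ℕ) : Prog (Stk D) (A ⊕ Bool) :=
  .seq (skipVar D i 0) <|
  .seq (.look .inp fun _ o => match o with
    | some (.inl a) => f a
    | _ => false) (rewind D)

/-- Set the flag if the relation with number `j` holds between the values of `x`, `y`, `z`: skip the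
word, and then the bits of the certificate that precede the one for this instance. -/
def relProg (D j x y z : ℕ) : Prog (Stk D) (A ⊕ Bool) :=
  .seq (.seq (skipPow D 1) (.seq (.rep .inp (skipPow D 3) j)
    (.seq (skipVar D x 2) (.seq (skipVar D y 1) (skipVar D z 0))))) <|
  .seq (.look .inp fun _ o => match o with
    | some (.inr b) => b
    | _ => false) (rewind D)

/-- The program that sets the flag to the truth value of a formula. -/
noncomputable def Fml.prog [Fintype J] (D : ℕ) : {d : ℕ} → Fml A J d → Prog (Stk D) (A ⊕ Bool)
  | _, .verum => .look .inp fun _ _ => true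
  | _, .lt i j => compare (lev D i) (lev D j)
  | _, .letter f i => letterProg D f i
  | _, .rel j x y z => relProg D (Fintype.equivFin J j) x y z
  | _, .not φ => .seq (φ.prog D) (.look .inp fun b _ => !b)
  | _, .and φ ψ => .seq (φ.prog D) (.ite (ψ.prog D) (.skip .inp))
  | d, .all φ =>
    .seq (.look .inp fun _ _ => true) <|
    .seq (.whl (.rem (lev D d)) (.seq (.ite (φ.prog D) (.skip .inp))
      (.move (.rem (lev D d)) (.var (lev D d))))) (.pour (.var (lev D d)) (.rem (lev D d)))

/-- The contents of the stacks during the evaluation of a formula: the input `I`, the word length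
`N`, and the values `e` of the variables. -/
def layout {D : ℕ} (I : List (A ⊕ Bool)) (N : ℕ) (e : Fin (D + 1) → ℕ) :
    Stk D → List (A ⊕ Bool)
  | .inp => I
  | .aux | .cntS _ | .varS _ => []
  | .cnt _ => List.replicate N unit
  | .rem l => List.replicate (N - e l) unit
  | .var l => List.replicate (e l) unit

section Programs

open Function (update)

variable {D : ℕ} {I : List (A ⊕ Bool)} {N B : ℕ} {e : Fin (D + 1) → ℕ}

/-- A bound for the running time of `skipPow`. -/
def powCost (B : ℕ) : ℕ → ℕ
  | 0 => 1
  | r + 1 => B * (powCost B r + 4) + 2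

theorem skips_skipPow (hB : N ≤ B) {r : ℕ} (hr : r ≤ 3) :
    Skips .inp .aux (layout I N e) (skipPow D r) (N ^ r)
      {k | ∃ i : Fin 3, i.val < r ∧ (k = .cnt i ∨ k = .cntS i)} (powCost B r) := by
  induction r with
  | zero => exact (Skips.move (by simp)).mono (Set.empty_subset _) le_rfl
  | succ r ih =>
    have hv : (Fin.ofNat 3 r).val = r := Nat.mod_eq_of_lt (by omega)
    rw [Nat.pow_succ, Nat.mul_comm]
    refine ((ih (by omega)).for (k := .cnt (Fin.ofNat 3 r)) (k' := .cntS (Fin.ofNat 3 r))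
      (x := N) (u := unit) (by simp) (by simp) (by simp) ?_ ?_ (by simp) (by simp) (by simp)
      (by simp) (by simp) rfl rfl hB).mono ?_ le_rfl
    · rintro ⟨i, hi, h | h⟩
      · rw [← Stk.cnt.inj h] at hi
        omega
      · cases h
    · rintro ⟨i, hi, h | h⟩
      · cases h
      · rw [← Stk.cntS.inj h] at hi
        omega
    · rintro k (rfl | rfl | ⟨i, hi, h⟩)
      · exact ⟨_, by omega, .inl rfl⟩
      · exact ⟨_, by omega, .inr rfl⟩
      · exact ⟨i, by omega, h⟩

theorem skips_skipVar (hB : N ≤ B) {r i : ℕ} (hr : r ≤ 3) (he : e (lev D i) ≤ B) :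
    Skips .inp .aux (layout I N e) (skipVar D i r) (e (lev D i) * N ^ r) {k | k ≠ .inp ∧ k ≠ .aux}
      (B * (powCost B r + 4) + 2) := by
  refine ((skips_skipPow hB hr).for (k := .var (lev D i)) (k' := .varS (lev D i))
    (u := unit) (by simp) (by simp) (by simp) (by simp) (by simp) (by simp) (by simp) (by simp)
    (by simp) (by simp) rfl rfl he).mono ?_ le_rfl
  rintro k (rfl | rfl | ⟨i, hi, rfl | rfl⟩) <;> simp

/-- Look up an input letter and put the input back. -/
theorem runsIn_lookup {p : Prog (Stk D) (A ⊕ Bool)} {m b : ℕ} {Z : Set (Stk D)}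
    {g : Bool → Option (A ⊕ Bool) → Bool}
    (hp : Skips .inp .aux (layout I N e) p m Z b) (f : Bool) :
    RunsIn (.seq p (.seq (.look .inp g) (rewind D))) f (layout I N e) (g f I[m]?) (layout I N e)
      (b + (1 + (I.length * 2 + 1))) := by
  refine (hp f _ fun _ _ => rfl).seq (RunsIn.seq (Runs.look.runsIn.to rfl le_rfl) ?_)
  have hflag : (advance .inp .aux m (layout I N e) .inp).head? = I[m]? := by
    simp [advance, layout, List.head?_drop]
  rw [hflag]
  refine (runsIn_pour (by simp) _ _).to ?_ ?_
  · funext k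
    cases k <;> simp [advance, layout]
  · simp [advance, layout]

theorem runsIn_letterProg (hB : N ≤ B) (f : A → Bool) {i : ℕ} (he : e (lev D i) ≤ B) (b : Bool) :
    ∃ b', (b' = true ↔ ∃ a, I[e (lev D i)]? = some (.inl a) ∧ f a = true) ∧
      RunsIn (letterProg D f i) b (layout I N e) b' (layout I N e)
        (B * (powCost B 0 + 4) + 2 + (1 + (I.length * 2 + 1))) := by
  refine ⟨_, ?_, runsIn_lookup (skips_skipVar hB (by simp) he) b⟩
  rw [Nat.pow_zero, Nat.mul_one]
  rcases I[e (lev D i)]? with _ | (a | c) <;> simp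

theorem runsIn_relProg (hB : N ≤ B) {j x y z : ℕ} (hx : e (lev D x) ≤ B) (hy : e (lev D y) ≤ B)
    (hz : e (lev D z) ≤ B) (b : Bool) :
    ∃ b', (b' = true ↔ I[N + (j * N ^ 3 + (e (lev D x) * N ^ 2 +
          (e (lev D y) * N + e (lev D z))))]? = some (.inr true)) ∧
      RunsIn (relProg D j x y z) b (layout I N e) b' (layout I N e)
        (powCost B 1 + (j * powCost B 3 + 1 + (B * (powCost B 2 + 4) + 2 +
          (B * (powCost B 1 + 4) + 2 + (B * (powCost B 0 + 4) + 2)))) +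
          (1 + (I.length * 2 + 1))) := by
  have hsub : ∀ r, {k : Stk D | ∃ i : Fin 3, i.val < r ∧ (k = .cnt i ∨ k = .cntS i)} ⊆
      {k | k ≠ .inp ∧ k ≠ .aux} := by
    rintro r k ⟨i, hi, rfl | rfl⟩ <;> simp
  have hia : (.inp : Stk D) ≠ .aux := by simp
  have h := ((skips_skipPow (I := I) (e := e) hB (r := 1) (by simp)).mono (hsub 1) le_rfl).seq hia
    (((((skips_skipPow (I := I) (e := e) hB (r := 3) (by simp)).mono (hsub 3) le_rfl).rep hia .inp
      (by simp) (by simp) j)).seq hia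
      ((skips_skipVar (I := I) hB (r := 2) (by simp) hx).seq hia
        ((skips_skipVar (I := I) hB (r := 1) (by simp) hy).seq hia
          (skips_skipVar (I := I) hB (r := 0) (by simp) hz) (by simp) (by simp))
        (by simp) (by simp)) (by simp) (by simp)) (by simp) (by simp)
  refine ⟨_, ?_, runsIn_lookup h b⟩
  rw [Nat.pow_one, Nat.pow_zero, Nat.mul_one]
  rcases I[N + (j * N ^ 3 + (e (lev D x) * N ^ 2 +
          (e (lev D y) * N + e (lev D z))))]? with _ | (a | c) <;> simp

theorem runsIn_compare {p q : Fin (D + 1)} (hp : e p ≤ B) (hq : e q ≤ B) (b : Bool) :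
    ∃ b', (b' = true ↔ e p < e q) ∧
      RunsIn (compare p q) b (layout I N e) b' (layout I N e) (B * 7 + 4) := by
  by_cases hpq : p = q
  · subst hpq
    refine ⟨false, by simp, ?_⟩
    rw [compare, if_pos rfl]
    exact Runs.look.runsIn.to rfl (by omega)
  rw [compare, if_neg hpq]
  refine ⟨decide (e p < e q), by simp, ?_⟩
  -- the state after `r` rounds of the first loop
  let T : ℕ → Stk D → List (A ⊕ Bool) := fun r =>
    update (update (update (update (layout I N e) (.var p) (List.replicate (e p - r) unit))
      (.varS p) (List.replicate r unit)) (.var q) (List.replicate (e q - r) unit))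
      (.varS q) (List.replicate (min r (e q)) unit)
  have h₁ := RunsIn.whl (i := .var p) (p := .seq (.move (.var p) (.varS p))
      (.move (.var q) (.varS q))) (b := 2) (e p) (fun _ => b) T
    (fun r hr => by simp [T, hpq]; omega)
    (by simp [T, hpq])
    (fun r hr => by
      refine RunsIn.seq (f₁ := b) (b₁ := 1) (b₂ := 1)
        (S₁ := update (update (T r) (.var p) (List.replicate (e p - (r + 1)) unit))
          (.varS p) (List.replicate (r + 1) unit)) ?_ ?_
      · refine (runsIn_move (a := unit) (l := List.replicate (e p - (r + 1)) unit) ?_ (by simp)).to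
          ?_ le_rfl
        · have : e p - r = (e p - (r + 1)) + 1 := by omega
          simp [T, hpq, this, List.replicate_succ]
        · simp [T, hpq, List.replicate_succ]
      · by_cases hry : r < e q
        · refine (runsIn_move (a := unit) (l := List.replicate (e q - (r + 1)) unit) ?_
            (by simp)).to ?_ le_rfl
          · have : e q - r = (e q - (r + 1)) + 1 := by omega
            simp [T, Ne.symm hpq, this, List.replicate_succ]
          · have h1 : min (r + 1) (e q) = min r (e q) + 1 := by omega
            funext k
            cases k <;> simp [T, h1, Function.update_apply, List.replicate_succ] <;> grind
        · refine (runsIn_move_nil ?_).to ?_ le_rfl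
          · have : e q - r = 0 := by omega
            simp [T, Ne.symm hpq, this]
          · have h1 : min (r + 1) (e q) = min r (e q) := by omega
            have h2 : e q - (r + 1) = e q - r := by omega
            funext k
            cases k <;> simp [T, h1, h2, Function.update_apply] <;> grind)
  have h₀ : T 0 = layout I N e := by
    funext k
    cases k <;> simp [T, Function.update_apply, layout]
    grind
  rw [h₀] at h₁
  have hflag : (List.head? (T (e p) (.var q))).isSome = decide (e p < e q) := by
    simp only [T, List.head?_replicate, ne_eq, reduceCtorEq, not_false_eq_true,
      Function.update_of_ne, Function.update_self]
    split_ifs with h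
    · simp; omega
    · simp; omega
  refine RunsIn.to (h₁.seq (RunsIn.seq (runsIn_look hflag) ((runsIn_pour (by simp) _ _).seq
    (runsIn_pour (by simp) _ _)))) (b' := B * 7 + 4) ?_ ?_
  · funext k
    cases k with
    | var l =>
      by_cases hl : l = q
      · subst hl
        simp [T, Function.update_apply, layout, Ne.symm hpq]
        omega
      · by_cases hl' : l = p
        · subst hl'
          simp [T, Function.update_apply, layout, hpq]
        · simp [T, Function.update_apply, layout, hl, hl']
    | _ => simp [T, Function.update_apply, layout] <;> grind
  · simp [T, hpq, Ne.symm hpq]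
    omega

/-- The values of the variables on all levels, with `0` on the levels that are not in use. -/
def assign {d : ℕ} (v : Fin d → ℕ) (l : Fin (D + 1)) : ℕ := if h : l.val < d then v ⟨l, h⟩ else 0

theorem assign_lev {d : ℕ} (hd : d ≤ D) (v : Fin d → ℕ) (i : Fin d) :
    assign v (lev D i) = v i := by
  have : (lev D i).val = i := Nat.mod_eq_of_lt (by omega)
  simp [assign, this]

theorem assign_snoc {d : ℕ} (hd : d ≤ D) (v : Fin d → ℕ) (x : ℕ) :
    assign (D := D) (Fin.snoc v x : Fin (d + 1) → ℕ) = update (assign v) (lev D d) x := by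
  have hv : (lev D d).val = d := Nat.mod_eq_of_lt (by omega)
  funext l
  by_cases hl : l = lev D d
  · subst hl
    simp [assign, hv, Fin.snoc]
  · have hne : l.val ≠ d := fun h => hl (Fin.ext (h.trans hv.symm))
    rw [Function.update_of_ne hl]
    by_cases hlt : l.val < d
    · have : l.val < d + 1 := by omega
      simp [assign, hlt, this, Fin.snoc]
    · have : ¬ l.val < d + 1 := by omega
      simp [assign, hlt, this]

end Programs

/-- A function that is given by a polynomial. -/
def IsPoly (f : ℕ → ℕ) : Prop := ∃ q : Polynomial ℕ, ∀ n, q.eval n = f n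

theorem IsPoly.const (k : ℕ) : IsPoly fun _ => k := ⟨Polynomial.C k, by simp⟩

theorem IsPoly.id : IsPoly fun n => n := ⟨Polynomial.X, by simp⟩

theorem IsPoly.add {f g : ℕ → ℕ} (hf : IsPoly f) (hg : IsPoly g) : IsPoly fun n => f n + g n :=
  let ⟨p, hp⟩ := hf
  let ⟨q, hq⟩ := hg
  ⟨p + q, fun n => by simp [hp, hq]⟩

theorem IsPoly.mul {f g : ℕ → ℕ} (hf : IsPoly f) (hg : IsPoly g) : IsPoly fun n => f n * g n :=
  let ⟨p, hp⟩ := hf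
  let ⟨q, hq⟩ := hg
  ⟨p * q, fun n => by simp [hp, hq]⟩

theorem isPoly_powCost (r : ℕ) : IsPoly fun n => powCost n r := by
  induction r with
  | zero => exact .const 1
  | succ r ih => exact (IsPoly.id.mul (ih.add (.const 4))).add (.const 2)

/-- The place of a bit in the list that represents a family of relations. -/
def bitIndex (N j x y z : ℕ) : ℕ := j * N ^ 3 + (x * N ^ 2 + (y * N + z))

/-- The family of relations that is represented by a list of bits. -/
noncomputable def relsOf [Fintype J] (N : ℕ) (s : List Bool) : Rels J := fun j x y z =>
  s[bitIndex N (Fintype.equivFin J j) x y z]?.getD false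

theorem getElem?_encodePair_left (w : List A) (s : List Bool) {x : ℕ} (hx : x < w.length) :
    (Complexity.encodePair (w, s))[x]? = some (.inl w[x]) := by
  simp [Complexity.encodePair, hx, List.getElem?_append]

theorem getElem?_encodePair_right (w : List A) (s : List Bool) (k : ℕ) :
    (Complexity.encodePair (w, s))[w.length + k]? = s[k]?.map .inr := by
  simp [Complexity.encodePair, List.getElem?_append]

theorem length_encodePair (w : List A) (s : List Bool) :
    (Complexity.encodePair (w, s)).length = w.length + s.length := by
  simp [Complexity.encodePair]

/-- The program of a formula computes its truth value in polynomial time. -/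
theorem Fml.runsIn_prog [Fintype J] {D d : ℕ} (φ : Fml A J d) (hD : d + φ.depth ≤ D) :
    ∃ T : ℕ → ℕ, IsPoly T ∧ ∀ (w : List A) (s : List Bool) (v : Fin d → ℕ),
      (∀ i, v i < w.length) → ∀ b, ∃ b', (b' = true ↔ φ.Holds w (relsOf w.length s) v) ∧
        RunsIn (φ.prog D) b (layout (Complexity.encodePair (w, s)) w.length (assign v)) b'
          (layout (Complexity.encodePair (w, s)) w.length (assign v))
          (T (w.length + s.length)) := by
  induction φ with
  | verum =>
    exact ⟨_, .const 1, fun w s v hv b => ⟨true, by simp [Fml.Holds], runsIn_look rfl⟩⟩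
  | @lt d i j =>
    simp only [Fml.depth, Nat.add_zero] at hD
    refine ⟨fun n => n * 7 + 4, (IsPoly.id.mul (.const 7)).add (.const 4), fun w s v hv b => ?_⟩
    have := hv i
    have := hv j
    obtain ⟨b', h, hr⟩ := runsIn_compare (I := Complexity.encodePair (w, s)) (N := w.length)
      (e := assign v) (p := lev D i) (q := lev D j) (B := w.length + s.length)
      (by rw [assign_lev hD]; omega) (by rw [assign_lev hD]; omega) b
    refine ⟨b', ?_, hr⟩
    rw [h, assign_lev hD, assign_lev hD]
    rfl
  | @letter d f i =>
    simp only [Fml.depth, Nat.add_zero] at hD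
    refine ⟨fun n => n * (powCost n 0 + 4) + 2 + (1 + (n * 2 + 1)),
      ((IsPoly.id.mul ((isPoly_powCost 0).add (.const 4))).add (.const 2)).add
        ((IsPoly.const 1).add ((IsPoly.id.mul (.const 2)).add (.const 1))), fun w s v hv b => ?_⟩
    have hi := hv i
    obtain ⟨b', h, hr⟩ := runsIn_letterProg (I := Complexity.encodePair (w, s)) (N := w.length)
      (e := assign v) (i := i) (B := w.length + s.length) (by omega) f
      (by rw [assign_lev hD]; omega) b
    rw [length_encodePair] at hr
    refine ⟨b', ?_, hr⟩
    rw [h, assign_lev hD, getElem?_encodePair_left w s hi]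
    simp [Fml.Holds, hi]
  | @rel d j x y z =>
    simp only [Fml.depth, Nat.add_zero] at hD
    have hP := fun r => (IsPoly.id.mul ((isPoly_powCost r).add (.const 4))).add (.const 2)
    refine ⟨fun n => _, ((isPoly_powCost 1).add
      ((((IsPoly.const (Fintype.equivFin J j)).mul (isPoly_powCost 3)).add (.const 1)).add
        ((hP 2).add ((hP 1).add (hP 0))))).add ((IsPoly.const 1).add
          ((IsPoly.id.mul (.const 2)).add (.const 1))), fun w s v hv b => ?_⟩
    have hx := hv x
    have hy := hv y
    have hz := hv z
    obtain ⟨b', h, hr⟩ := runsIn_relProg (I := Complexity.encodePair (w, s)) (N := w.length)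
      (e := assign v) (j := Fintype.equivFin J j) (x := x) (y := y) (z := z)
      (B := w.length + s.length) (by omega)
      (by rw [assign_lev hD]; omega) (by rw [assign_lev hD]; omega)
      (by rw [assign_lev hD]; omega) b
    rw [length_encodePair] at hr
    refine ⟨b', ?_, hr⟩
    rw [h, assign_lev hD, assign_lev hD, assign_lev hD, getElem?_encodePair_right]
    simp only [Fml.Holds, relsOf, bitIndex]
    rcases s[_]? with _ | _ <;> simp
  | not φ ih =>
    obtain ⟨T, hT, h⟩ := ih hD
    refine ⟨_, hT.add (.const 1), fun w s v hv b => ?_⟩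
    obtain ⟨b', hb, hr⟩ := h w s v hv b
    exact ⟨!b', by simp [Fml.Holds, ← hb], hr.seq (runsIn_look rfl)⟩
  | and φ ψ ih₁ ih₂ =>
    simp only [Fml.depth] at hD
    obtain ⟨T₁, hT₁, h₁⟩ := ih₁ (by omega)
    obtain ⟨T₂, hT₂, h₂⟩ := ih₂ (by omega)
    refine ⟨_, hT₁.add (((IsPoly.const 1).add hT₂).add (.const 1)), fun w s v hv b => ?_⟩
    obtain ⟨b₁, hb₁, hr₁⟩ := h₁ w s v hv b
    obtain ⟨b₂, hb₂, hr₂⟩ := h₂ w s v hv true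
    refine ⟨b₁ && b₂, by simp [Fml.Holds, ← hb₁, ← hb₂], hr₁.seq (RunsIn.ite ?_ ?_)⟩
    · rintro rfl
      exact hr₂
    · rintro rfl
      exact runsIn_skip _ _ _
  | @all d φ ih =>
    simp only [Fml.depth] at hD
    have hd : d ≤ D := by omega
    obtain ⟨T, hT, h⟩ := ih (by omega)
    refine ⟨fun n => 1 + ((n * (1 + T n + 1 + 1 + 1) + 1) + (n * 2 + 1)),
      (IsPoly.const 1).add (((IsPoly.id.mul (((((IsPoly.const 1).add hT).add (.const 1)).add
        (.const 1)).add (.const 1))).add (.const 1)).add ((IsPoly.id.mul (.const 2)).add (.const 1))),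
      fun w s v hv b => ?_⟩
    classical
    set I := Complexity.encodePair (w, s)
    set N := w.length
    let P : ℕ → Prop := fun x => φ.Holds w (relsOf N s) (Fin.snoc v x)
    let F : ℕ → Bool := fun x => decide (∀ y < x, P y)
    have h₁ := RunsIn.whl (i := .rem (lev D d)) (p := .seq (.ite (φ.prog D) (.skip .inp))
      (.move (.rem (lev D d)) (.var (lev D d)))) (b := 1 + T (N + s.length) + 1 + 1) N
      F
      (fun x => layout I N (Function.update (assign v) (lev D d) x))
      (fun x hx => by simp [layout]; omega)
      (by simp [layout])
      (fun x hx => by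
        obtain ⟨b', hb, hr⟩ := h w s (Fin.snoc v x)
          (fun i => by refine Fin.lastCases ?_ (fun i => ?_) i <;> simp [hv, hx, N]) true
        rw [assign_snoc hd] at hr
        refine RunsIn.seq (f₁ := F (x + 1))
          (S₁ := layout I N (Function.update (assign v) (lev D d) x)) (RunsIn.ite (fun hf => ?_)
          (fun hf => ?_)) ((runsIn_move (a := unit) (l := List.replicate (N - (x + 1)) unit) ?_
            (by simp)).to ?_ le_rfl)
        · convert hr using 1
          rw [Bool.eq_iff_iff, hb]
          simp only [F, decide_eq_true_eq] at hf ⊢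
          exact ⟨fun h' => h' x (by omega), fun h' y hy =>
            (Nat.lt_succ_iff_lt_or_eq.1 hy).elim (hf y) fun e => e ▸ h'⟩
        · have : F (x + 1) = false := by
            simp only [F, decide_eq_false_iff_not] at hf ⊢
            exact fun h' => hf fun y hy => h' y (by omega)
          rw [this]
          exact runsIn_skip _ _ _
        · have : N - x = (N - (x + 1)) + 1 := by omega
          simp [layout, this, List.replicate_succ]
        · funext k
          cases k <;> simp [layout, Function.update_apply] <;> grind)
    have hz : assign v (lev D d) = 0 := by
      have : (lev D d).val = d := Nat.mod_eq_of_lt (by omega)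
      simp [assign, this]
    have h₀ : Function.update (assign v) (lev D d) 0 = assign v := by
      rw [← hz, Function.update_eq_self]
    rw [h₀, show F 0 = true by simp [F]] at h₁
    refine ⟨F N, ?_, (runsIn_look rfl).seq
      (RunsIn.seq (h₁.to rfl ?_) ((runsIn_pour (by simp) _ _).to ?_ ?_))⟩
    · simp [F, P, Fml.Holds, N]
    · gcongr
      omega
    · funext k
      cases k <;> simp [layout, Function.update_apply] <;> grind
    · simp [layout]

end WordLogic

/-! ### Existential second-order properties are in NP -/

namespace WordLogic

open StackProgram

variable {A J : Type}

theorem Fml.holds_congr {w : List A} {T T' : Rels J}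
    (hT : ∀ j, ∀ x < w.length, ∀ y < w.length, ∀ z < w.length, T j x y z = T' j x y z)
    {d : ℕ} (φ : Fml A J d) {v : Fin d → ℕ} (hv : ∀ i, v i < w.length) :
    φ.Holds w T v ↔ φ.Holds w T' v := by
  induction φ with
  | verum | lt | letter => rfl
  | rel j x y z => simp only [Holds, hT j _ (hv x) _ (hv y) _ (hv z)]
  | not φ ih => exact not_congr (ih hv)
  | and φ ψ ih₁ ih₂ => exact and_congr (ih₁ hv) (ih₂ hv)
  | all φ ih =>
    refine forall₂_congr fun x hx => ih fun i => ?_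
    refine Fin.lastCases ?_ (fun i => ?_) i <;> simp [hv, hx]

theorem bitIndex_inj {N j x y z j' x' y' z' : ℕ} (hx : x < N) (hy : y < N) (hz : z < N)
    (hx' : x' < N) (hy' : y' < N) (hz' : z' < N)
    (h : bitIndex N j x y z = bitIndex N j' x' y' z') : j = j' ∧ x = x' ∧ y = y' ∧ z = z' := by
  have aux : ∀ {a b a' b' : ℕ}, b < N → b' < N → N * a + b = N * a' + b' → a = a' ∧ b = b' := by
    intro a b a' b' hb hb' h
    have h₁ := congrArg (· / N) h
    have h₂ := congrArg (· % N) h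
    simp only [Nat.mul_add_mod, Nat.mod_eq_of_lt hb, Nat.mod_eq_of_lt hb'] at h₂
    rw [h₂] at h
    exact ⟨Nat.eq_of_mul_eq_mul_left (by omega) (Nat.add_right_cancel h), h₂⟩
  have e : ∀ j x y z, bitIndex N j x y z = N * (N * (N * j + x) + y) + z := by
    intro j x y z
    unfold bitIndex
    ring
  rw [e, e] at h
  obtain ⟨h, h₁⟩ := aux hz hz' h
  obtain ⟨h, h₂⟩ := aux hy hy' h
  obtain ⟨h, h₃⟩ := aux hx hx' h
  exact ⟨h, h₃, h₂, h₁⟩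

theorem bitIndex_lt {N j k x y z : ℕ} (hj : j < k) (hx : x < N) (hy : y < N) (hz : z < N) :
    bitIndex N j x y z < k * N ^ 3 := by
  have h₁ : (j + 1) * N ^ 3 ≤ k * N ^ 3 := Nat.mul_le_mul_right _ hj
  have h₂ : (x + 1) * N ^ 2 ≤ N * N ^ 2 := Nat.mul_le_mul_right _ hx
  have h₃ : (y + 1) * N ≤ N * N := Nat.mul_le_mul_right _ hy
  have e₁ : (j + 1) * N ^ 3 = j * N ^ 3 + N ^ 3 := by ring
  have e₂ : (x + 1) * N ^ 2 = x * N ^ 2 + N ^ 2 := by ring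
  have e₃ : (y + 1) * N = y * N + N := by ring
  have e₄ : N * N ^ 2 = N ^ 3 := by ring
  have e₅ : N * N = N ^ 2 := by ring
  unfold bitIndex
  omega

/-- Every family of relations on the positions of a word is represented by a list of bits whose
length is polynomial in the length of the word. -/
theorem exists_relsOf_eq [Fintype J] (N : ℕ) (T : Rels J) :
    ∃ s : List Bool, s.length = Fintype.card J * N ^ 3 ∧
      ∀ j, ∀ x < N, ∀ y < N, ∀ z < N, relsOf N s j x y z = T j x y z := by
  classical
  let E := Fintype.equivFin J
  refine ⟨List.ofFn fun i : Fin (Fintype.card J * N ^ 3) => decide (∃ j x y z,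
    x < N ∧ y < N ∧ z < N ∧ bitIndex N (E j) x y z = i ∧ T j x y z = true), by simp, ?_⟩
  intro j x hx y hy z hz
  rw [relsOf, List.getElem?_ofFn, dif_pos (bitIndex_lt (E j).isLt hx hy hz), Option.getD_some,
    Bool.eq_iff_iff, decide_eq_true_iff]
  constructor
  · rintro ⟨j', x', y', z', hx', hy', hz', h, hT⟩
    obtain ⟨h₁, rfl, rfl, rfl⟩ := bitIndex_inj hx' hy' hz' hx hy hz h
    rwa [E.injective (Fin.ext h₁)] at hT
  · exact fun h => ⟨j, x, y, z, hx, hy, hz, rfl, h⟩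

/-- The stacks that hold as many elements as the word has letters when the evaluation starts. -/
def counters (D : ℕ) : List (Stk D) :=
  (List.finRange 3).map .cnt ++ (List.finRange (D + 1)).map .rem

theorem nodup_counters (D : ℕ) : (counters D).Nodup := by
  refine List.Nodup.append ((List.nodup_finRange _).map fun _ _ => Stk.cnt.inj)
    ((List.nodup_finRange _).map fun _ _ => Stk.rem.inj) ?_
  simp [List.disjoint_left]

/-- Set up the counters: every letter of the word that precedes the certificate is counted. -/
def setup (D : ℕ) : Prog (Stk D) (A ⊕ Bool) :=
  .seq (.whl .inp (.seq (.look .inp fun _ o => o.any Sum.isLeft)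
    (.seq (.ite (.pushAll .inp unit (counters D)) (.skip .inp)) (.move .inp .aux))))
    (.pour .aux .inp)

theorem runsIn_setup (D : ℕ) (w : List A) (s : List Bool) :
    ∃ b, RunsIn (setup D) false
      (Function.update (fun _ => []) .inp (Complexity.encodePair (w, s))) b
      (layout (Complexity.encodePair (w, s)) w.length (assign (D := D) (d := 0) Fin.elim0))
      ((w.length + s.length) * ((counters D).length + 8) + 2) := by
  rw [← length_encodePair]
  have hw : (Complexity.encodePair (w, s)).countP Sum.isLeft = w.length := by
    simp [Complexity.encodePair, List.countP_map, Function.comp_def]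
  set I := Complexity.encodePair (w, s)
  -- the state after `r` letters have been read
  let T : ℕ → Stk D → List (A ⊕ Bool) := fun r k => match k with
    | .inp => I.drop r
    | .aux => (I.take r).reverse
    | .cnt _ | .rem _ => List.replicate ((I.take r).countP Sum.isLeft) unit
    | _ => []
  let F : ℕ → Bool := fun r => (I.take r).getLast?.any Sum.isLeft
  have hmem : ∀ k, (counters D).count k = match k with
      | .cnt _ | .rem _ => 1
      | _ => 0 := by
    intro k
    rw [(nodup_counters D).count]
    cases k <;> simp [counters]
  have h₁ := RunsIn.whl (i := (.inp : Stk D))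
    (p := .seq (.look .inp fun _ o => o.any Sum.isLeft)
      (.seq (.ite (.pushAll .inp unit (counters D)) (.skip .inp)) (.move .inp .aux)))
    (b := 1 + (1 + ((counters D).length + 1) + 1 + 1)) I.length F T
    (fun r hr => by simp [T, hr]) (by simp [T])
    (fun r hr => by
      have hF : F (r + 1) = I[r].isLeft := by
        simp [F, List.take_succ_eq_append_getElem hr, -List.take_append_getElem]
      have hd : T r .inp = I[r] :: I.drop (r + 1) :=
        List.drop_eq_getElem_cons hr
      refine (runsIn_look (f' := F (r + 1)) ?_).seq (RunsIn.seq (f₁ := F (r + 1))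
        (S₁ := fun k => match k with
          | .inp => I.drop r
          | .aux => (I.take r).reverse
          | .cnt _ | .rem _ => List.replicate ((I.take (r + 1)).countP Sum.isLeft) unit
          | _ => [])
        (RunsIn.ite (fun hf => ?_) fun hf => ?_)
        ((runsIn_move (a := I[r]) (l := I.drop (r + 1)) ?_ (by simp)).to ?_ le_rfl))
      · rw [hd, hF]
        rfl
      · rw [hf]
        rw [hF] at hf
        refine (runsIn_pushAll _ _ _ _ _).to ?_ le_rfl
        funext k
        rw [hmem]
        cases k <;> simp [T, List.take_succ_eq_append_getElem hr, -List.take_append_getElem, hf,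
          List.replicate_succ]
      · rw [hf]
        rw [hF] at hf
        refine (runsIn_skip _ _ _).to ?_ le_rfl
        funext k
        cases k <;> simp [T, List.take_succ_eq_append_getElem hr, -List.take_append_getElem, hf]
      · exact hd
      · funext k
        cases k <;> simp [T, List.take_succ_eq_append_getElem hr, -List.take_append_getElem])
  have h₀ : T 0 = Function.update (fun _ => []) .inp I := by
    funext k
    cases k <;> simp [T]
  rw [h₀] at h₁
  refine ⟨_, (h₁.seq (runsIn_pour (by simp) _ _)).to ?_ ?_⟩
  · funext k
    cases k <;> simp [T, layout, assign, hw]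
  · simp only [T, List.length_reverse, List.length_take, min_self]
    ring_nf
    omega

/-- A language that is defined by an existential second-order sentence is in NP: a certificate lists
the values of the relations, and the sentence is evaluated with them. -/
theorem mem_NP_of_fml [Fintype A] [Fintype J] {L : Language A} (φ : Fml A J 0)
    (h : ∀ w, w ∈ L ↔ ∃ T : Rels J, φ.Holds w T Fin.elim0) : L ∈ Complexity.NP A := by
  classical
  refine ⟨fun a => decide (φ.Holds a.1 (relsOf a.1.length a.2) Fin.elim0),
    Polynomial.C (Fintype.card J) * Polynomial.X ^ 3, ?_, fun w => ?_⟩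
  · obtain ⟨T, ⟨q, hq⟩, hT⟩ := φ.runsIn_prog (D := φ.depth) (by omega)
    set D := φ.depth
    obtain ⟨q', hq'⟩ : IsPoly fun n => (n * ((counters D).length + 8) + 2) +
        (T n + ((Finset.univ : Finset (Stk D)).toList.length * (n * 2 + 1) + 1)) :=
      ((IsPoly.id.mul (.const _)).add (.const 2)).add (IsPoly.add ⟨q, hq⟩
        (((IsPoly.const _).mul ((IsPoly.id.mul (.const 2)).add (.const 1))).add (.const 1)))
    refine computableInPolyTime (.seq (setup D) (.seq (φ.prog D)
      (.clearAll .inp (Finset.univ : Finset (Stk D)).toList))) .inp q' fun a => ?_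
    obtain ⟨w, s⟩ := a
    obtain ⟨b, h₁⟩ := runsIn_setup D w s
    obtain ⟨b', hb, h₂⟩ := hT w s Fin.elim0 (fun i => i.elim0) b
    have h₃ := runsIn_clearAll (.inp : Stk D) (Finset.univ : Finset (Stk D)).toList b'
      (layout (Complexity.encodePair (w, s)) w.length (assign (D := D) (d := 0) Fin.elim0))
      (w.length + s.length) (fun k => by cases k <;> simp [layout, assign, length_encodePair])
    have h₄ := h₁.seq (h₂.seq h₃)
    rw [hq', length_encodePair]
    have e : decide (φ.Holds w (relsOf w.length s) Fin.elim0) = b' := by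
      rw [Bool.eq_iff_iff, hb, decide_eq_true_iff]
    simp only [e]
    simpa [RunsIn] using h₄
  · rw [h]
    constructor
    · rintro ⟨T, hT⟩
      obtain ⟨s, hs, hsT⟩ := exists_relsOf_eq w.length T
      refine ⟨s, by simp [hs], ?_⟩
      rw [decide_eq_true_iff]
      exact (φ.holds_congr hsT fun i => i.elim0).2 hT
    · rintro ⟨s, -, hs⟩
      exact ⟨_, of_decide_eq_true hs⟩

end WordLogic

/-! ### Definable predicates -/

namespace WordLogic

variable {A J : Type}

/-- A predicate of positions in words with relations is definable if it is expressed by a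
first-order formula. -/
def Definable (d : ℕ) (P : List A → Rels J → (Fin d → ℕ) → Prop) : Prop :=
  ∃ φ : Fml A J d, ∀ w T v, (∀ i, v i < w.length) → (φ.Holds w T v ↔ P w T v)

namespace Definable

variable {d : ℕ} {P Q : List A → Rels J → (Fin d → ℕ) → Prop}

theorem congr (hP : Definable d P)
    (h : ∀ w T v, (∀ i, v i < w.length) → (P w T v ↔ Q w T v)) : Definable d Q :=
  let ⟨φ, hφ⟩ := hP
  ⟨φ, fun w T v hv => (hφ w T v hv).trans (h w T v hv)⟩

theorem not (hP : Definable d P) : Definable d fun w T v => ¬ P w T v :=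
  let ⟨φ, hφ⟩ := hP
  ⟨.not φ, fun w T v hv => not_congr (hφ w T v hv)⟩

theorem and (hP : Definable d P) (hQ : Definable d Q) :
    Definable d fun w T v => P w T v ∧ Q w T v :=
  let ⟨φ, hφ⟩ := hP
  let ⟨ψ, hψ⟩ := hQ
  ⟨.and φ ψ, fun w T v hv => and_congr (hφ w T v hv) (hψ w T v hv)⟩

theorem imp (hP : Definable d P) (hQ : Definable d Q) :
    Definable d fun w T v => P w T v → Q w T v :=
  (hP.and hQ.not).not.congr fun _ _ _ _ => by tauto

theorem iff (hP : Definable d P) (hQ : Definable d Q) :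
    Definable d fun w T v => P w T v ↔ Q w T v :=
  ((hP.imp hQ).and (hQ.imp hP)).congr fun _ _ _ _ => by tauto

theorem all {R : List A → Rels J → (Fin d → ℕ) → ℕ → Prop}
    (hR : Definable (d + 1) fun w T v => R w T (Fin.init v) (v (Fin.last d))) :
    Definable d fun w T v => ∀ x < w.length, R w T v x := by
  obtain ⟨φ, hφ⟩ := hR
  refine ⟨.all φ, fun w T v hv => forall₂_congr fun x hx => ?_⟩
  rw [hφ w T (Fin.snoc v x) fun i => ?_]
  · simp
  · refine Fin.lastCases ?_ (fun i => ?_) i <;> simp [hv, hx]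

theorem ex {R : List A → Rels J → (Fin d → ℕ) → ℕ → Prop}
    (hR : Definable (d + 1) fun w T v => R w T (Fin.init v) (v (Fin.last d))) :
    Definable d fun w T v => ∃ x < w.length, R w T v x :=
  (all (R := fun w T v x => ¬ R w T v x) hR.not).not.congr fun _ _ _ _ => by push Not; rfl

theorem lt (i j : Fin d) : Definable d fun (_ : List A) (_ : Rels J) v => v i < v j :=
  ⟨.lt i j, fun _ _ _ _ => Iff.rfl⟩

theorem le (i j : Fin d) : Definable d fun (_ : List A) (_ : Rels J) v => v i ≤ v j :=
  (lt j i).not.congr fun _ _ _ _ => not_lt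

theorem eq (i j : Fin d) : Definable d fun (_ : List A) (_ : Rels J) v => v i = v j :=
  ((le i j).and (le j i)).congr fun _ _ _ _ => by omega

theorem rel (k : J) (x y z : Fin d) :
    Definable d fun (_ : List A) (T : Rels J) v => T k (v x) (v y) (v z) = true :=
  ⟨.rel k x y z, fun _ _ _ _ => Iff.rfl⟩

theorem const (p : Prop) : Definable d fun (_ : List A) (_ : Rels J) _ => p := by
  by_cases hp : p
  · exact ⟨.verum, fun _ _ _ _ => by simp [Fml.Holds, hp]⟩
  · exact ⟨.not .verum, fun _ _ _ _ => by simp [Fml.Holds, hp]⟩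

theorem letter [DecidableEq A] (a : A) (i : Fin d) :
    Definable d fun w (_ : Rels J) v => w[v i]? = some a :=
  ⟨.letter (fun x => decide (x = a)) i, fun _ _ _ _ => by simp [Fml.Holds]⟩

theorem succ (i j : Fin d) : Definable d fun (_ : List A) (_ : Rels J) v => v j = v i + 1 := by
  refine Definable.congr ((lt i j).and (all (R := fun _ _ v x => v i < x → v j ≤ x)
    ((lt i.castSucc (Fin.last d)).imp (le j.castSucc (Fin.last d))))) fun w T v hv => ?_
  have := hv j
  constructor
  · rintro ⟨h₁, h₂⟩
    have := h₂ (v i + 1) (by omega)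
    omega
  · intro h
    exact ⟨by omega, fun x _ _ => by omega⟩

end Definable

end WordLogic

/-! ### Boards as words with a coordinate system -/

namespace Checkers

open WordLogic

/-- The position in the encoding of a board at which the contents of a square are written. -/
def pos {n : ℕ} (s : Square n) : ℕ := (n + 1) * s.1 + s.2

theorem pos_div {n : ℕ} (s : Square n) : pos s / (n + 1) = s.1 := by
  have := s.2.isLt
  rw [pos, Nat.mul_add_div (by omega), Nat.div_eq_of_lt (by omega), Nat.add_zero]

theorem pos_mod {n : ℕ} (s : Square n) : pos s % (n + 1) = s.2 := by
  have := s.2.isLt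
  rw [pos, Nat.mul_add_mod, Nat.mod_eq_of_lt (by omega)]

theorem pos_injective (n : ℕ) : Function.Injective (pos (n := n)) := fun s t h =>
  Prod.ext (Fin.ext (by rw [← pos_div, h, pos_div])) (Fin.ext (by rw [← pos_mod, h, pos_mod]))

/-- The letter at position `p` in the encoding of a board. -/
def symbolAt {n : ℕ} (b : Board n) (p : ℕ) : Symbol :=
  if h : p / (n + 1) < n ∧ p % (n + 1) < n then .cell (b (⟨_, h.1⟩, ⟨_, h.2⟩)) else .endRow

theorem symbolAt_pos {n : ℕ} (b : Board n) (s : Square n) : symbolAt b (pos s) = .cell (b s) := by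
  have h₁ := pos_div s
  have h₂ := pos_mod s
  rw [symbolAt, dif_pos ⟨by omega, by omega⟩]
  exact congrArg _ (congrArg _ (Prod.ext (Fin.ext h₁) (Fin.ext h₂)))

theorem encodeBoard_eq {n : ℕ} (b : Board n) :
    encodeBoard b = List.ofFn fun p : Fin (n * (n + 1)) => symbolAt b p := by
  rw [List.ofFn_mul, encodeBoard, List.flatMap, List.ofFn_eq_map]
  congr 1
  refine List.map_congr_left fun i _ => ?_
  rw [List.ofFn_succ', List.concat_eq_append, List.ofFn_eq_map]
  congr 1
  · refine List.map_congr_left fun j _ => ?_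
    have := symbolAt_pos b (i, j)
    rw [← this]
    simp [pos, Nat.mul_comm]
  · simp [symbolAt]

theorem length_encodeBoard {n : ℕ} (b : Board n) : (encodeBoard b).length = n * (n + 1) := by
  simp [encodeBoard_eq]

theorem getElem?_encodeBoard {n : ℕ} (b : Board n) {p : ℕ} (hp : p < n * (n + 1)) :
    (encodeBoard b)[p]? = some (symbolAt b p) := by
  rw [encodeBoard_eq, List.getElem?_ofFn, dif_pos hp]

theorem pos_lt {n : ℕ} (s : Square n) : pos s < n * (n + 1) := by
  have h₁ := s.1.isLt
  have h₂ := s.2.isLt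
  have : (n + 1) * (s.1 + 1) ≤ (n + 1) * n := Nat.mul_le_mul_left _ h₁
  rw [Nat.mul_succ] at this
  rw [pos, Nat.mul_comm n]
  omega

/-- The names of the relations that describe the coordinate system of a board: the row and the
column of a position, and the two binary digits of the residue of a number modulo `4`. -/
inductive Coord
  | row
  | col
  | bit₀
  | bit₁
  deriving DecidableEq

instance : Fintype Coord := ⟨{.row, .col, .bit₀, .bit₁}, fun c => by cases c <;> simp⟩

/-- A board together with a family of ternary relations between its squares. -/
structure Frame (J : Type) where
  n : ℕ
  b : Board n
  R : J → Square n → Square n → Square n → Bool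

/-- The word `w` is the encoding of the board of the frame `F`, and the relations `T` describe its
coordinate system and the relations of the frame. -/
structure Represents {J : Type} (w : List Symbol) (T : Rels (Coord ⊕ J)) (F : Frame J) : Prop where
  word : w = encodeBoard F.b
  row : ∀ p < w.length, ∀ x < w.length, (T (.inl .row) p x x = true ↔ x = p / (F.n + 1))
  col : ∀ p < w.length, ∀ x < w.length, (T (.inl .col) p x x = true ↔ x = p % (F.n + 1))
  bit₀ : ∀ x < w.length, (T (.inl .bit₀) x x x = true ↔ x % 2 = 1)
  bit₁ : ∀ x < w.length, (T (.inl .bit₁) x x x = true ↔ 2 ≤ x % 4)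
  rel : ∀ j s t u, T (.inr j) (pos s) (pos t) (pos u) = F.R j s t u

/-- The first-order condition that a word is the encoding of a board with at least one square and
that the relations `Coord` are those of its coordinate system. The number of rows is `e`. -/
def Format {J : Type} (w : List Symbol) (T : Rels (Coord ⊕ J)) : Prop :=
  ∃ e < w.length,
    (∀ p < w.length, ∀ r < w.length, ∀ c < w.length,
      T (.inl .row) p r r = true → T (.inl .col) p c c = true →
        ((w[p]? = some .endRow ↔ c = e) ∧ r < e ∧
          ((∀ q < w.length, q ≤ p) → e = r + 1 ∧ c = e))) ∧
    (∀ p < w.length, (∀ q < w.length, p ≤ q) →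
      (∀ x < w.length, (T (.inl .row) p x x = true ↔ x = p) ∧
        (T (.inl .col) p x x = true ↔ x = p)) ∧
      ¬ T (.inl .bit₀) p p p = true ∧ ¬ T (.inl .bit₁) p p p = true) ∧
    (∀ p < w.length, ∀ q < w.length, q = p + 1 →
      (T (.inl .bit₀) q q q = true ↔ ¬ T (.inl .bit₀) p p p = true) ∧
      (T (.inl .bit₁) q q q = true ↔
        ¬ (T (.inl .bit₁) p p p = true ↔ T (.inl .bit₀) p p p = true)) ∧
      ∀ r < w.length, ∀ c < w.length,
        T (.inl .row) p r r = true → T (.inl .col) p c c = true →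
          (w[p]? = some .endRow → ∀ x < w.length, (T (.inl .row) q x x = true ↔ x = r + 1) ∧
            (T (.inl .col) q x x = true ↔ ∀ y < w.length, x ≤ y)) ∧
          (¬ w[p]? = some .endRow → ∀ x < w.length, (T (.inl .row) q x x = true ↔ x = r) ∧
            (T (.inl .col) q x x = true ↔ x = c + 1)))

theorem definable_format {J : Type} :
    Definable 0 fun w (T : Rels (Coord ⊕ J)) _ => Format w T := by
  unfold Format
  refine .ex (.and ?_ (.and ?_ ?_))
  · exact .all <| .all <| .all <| .imp (.rel _ _ _ _) <| .imp (.rel _ _ _ _) <|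
      .and (.iff (.letter _ _) (.eq _ _)) <| .and (.lt _ _) <|
      .imp (.all (.le _ _)) <| .and (.succ _ _) (.eq _ _)
  · exact .all <| .imp (.all (.le _ _)) <| .and
      (.all <| .and (.iff (.rel _ _ _ _) (.eq _ _)) (.iff (.rel _ _ _ _) (.eq _ _))) <|
      .and (.not (.rel _ _ _ _)) (.not (.rel _ _ _ _))
  · exact .all <| .all <| .imp (.succ _ _) <| .and (.iff (.rel _ _ _ _) (.not (.rel _ _ _ _))) <|
      .and (.iff (.rel _ _ _ _) (.not (.iff (.rel _ _ _ _) (.rel _ _ _ _)))) <|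
      .all <| .all <| .imp (.rel _ _ _ _) <| .imp (.rel _ _ _ _) <| .and
        (.imp (.letter _ _) <| .all <| .and (.iff (.rel _ _ _ _) (.succ _ _))
          (.iff (.rel _ _ _ _) (.all (.le _ _))))
        (.imp (.not (.letter _ _)) <| .all <| .and (.iff (.rel _ _ _ _) (.eq _ _))
          (.iff (.rel _ _ _ _) (.succ _ _)))

theorem div_mod_succ_of_eq {m p : ℕ} (h : p % (m + 1) = m) :
    (p + 1) / (m + 1) = p / (m + 1) + 1 ∧ (p + 1) % (m + 1) = 0 := by
  have e := Nat.div_add_mod p (m + 1)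
  have : p + 1 = (m + 1) * (p / (m + 1) + 1) := by
    rw [Nat.mul_succ]
    omega
  rw [this, Nat.mul_div_cancel_left _ (by omega), Nat.mul_mod_right]
  exact ⟨rfl, rfl⟩

theorem div_mod_succ_of_ne {m p : ℕ} (h : p % (m + 1) ≠ m) :
    (p + 1) / (m + 1) = p / (m + 1) ∧ (p + 1) % (m + 1) = p % (m + 1) + 1 := by
  have e := Nat.div_add_mod p (m + 1)
  have hlt := Nat.mod_lt p (by omega : m + 1 > 0)
  have : p + 1 = (m + 1) * (p / (m + 1)) + (p % (m + 1) + 1) := by omega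
  rw [this, Nat.mul_add_div (by omega), Nat.div_eq_of_lt (a := p % (m + 1) + 1) (by omega),
    Nat.mul_add_mod, Nat.mod_eq_of_lt (a := p % (m + 1) + 1) (by omega)]
  exact ⟨by omega, rfl⟩

theorem symbolAt_eq_endRow {n : ℕ} (b : Board n) {p : ℕ} (hp : p < n * (n + 1)) :
    symbolAt b p = .endRow ↔ p % (n + 1) = n := by
  have h₁ : p / (n + 1) < n := Nat.div_lt_of_lt_mul (by rwa [Nat.mul_comm])
  have h₂ := Nat.mod_lt p (by omega : n + 1 > 0)
  unfold symbolAt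
  split_ifs with h
  · simp only [false_iff]
    omega
  · simp only [true_iff]
    omega

namespace Represents

variable {J : Type} {w : List Symbol} {T : Rels (Coord ⊕ J)} {F : Frame J}

theorem length (h : Represents w T F) : w.length = F.n * (F.n + 1) := by
  rw [h.word, length_encodeBoard]

theorem pos_lt (h : Represents w T F) (s : Square F.n) : pos s < w.length := by
  rw [h.length]
  exact Checkers.pos_lt s

theorem getElem?_pos (h : Represents w T F) (s : Square F.n) :
    w[pos s]? = some (.cell (F.b s)) := by
  conv_lhs => rw [h.word]
  rw [getElem?_encodeBoard _ (Checkers.pos_lt s), symbolAt_pos]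

theorem getElem?_eq_endRow (h : Represents w T F) {p : ℕ} (hp : p < w.length) :
    w[p]? = some .endRow ↔ p % (F.n + 1) = F.n := by
  rw [h.length] at hp
  conv_lhs => rw [h.word]
  rw [getElem?_encodeBoard _ hp, Option.some_inj, symbolAt_eq_endRow _ hp]

theorem format (h : Represents w T F) (hn : 0 < F.n) : Format w T := by
  have hN := h.length
  have hn' : F.n < w.length := by
    rw [hN]
    nlinarith
  refine ⟨F.n, hn', ?_, ?_, ?_⟩
  · intro p hp r hr c hc hpr hpc
    rw [h.row p hp r hr] at hpr
    rw [h.col p hp c hc] at hpc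
    subst hpr hpc
    refine ⟨h.getElem?_eq_endRow hp, Nat.div_lt_of_lt_mul (by rwa [Nat.mul_comm, ← hN]), ?_⟩
    intro hlast
    have hp' : p = (F.n + 1) * (F.n - 1) + F.n := by
      have := hlast (w.length - 1) (by omega)
      have e : F.n * (F.n + 1) = (F.n + 1) * (F.n - 1) + F.n + 1 := by
        obtain ⟨k, hk⟩ := Nat.exists_eq_succ_of_ne_zero hn.ne'
        rw [hk]
        simp only [Nat.succ_eq_add_one, Nat.add_sub_cancel]
        ring
      omega
    rw [hp', Nat.mul_add_div (by omega), Nat.div_eq_of_lt (by omega), Nat.mul_add_mod,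
      Nat.mod_eq_of_lt (by omega)]
    omega
  · intro p hp hfirst
    obtain rfl : p = 0 := by
      have := hfirst 0 (by omega)
      omega
    rw [h.bit₀ 0 hp, h.bit₁ 0 hp]
    refine ⟨fun x hx => ?_, by simp⟩
    rw [h.row 0 hp x hx, h.col 0 hp x hx]
    simp
  · rintro p hp q hq rfl
    rw [h.bit₀ _ hp, h.bit₁ _ hp, h.bit₀ _ hq, h.bit₁ _ hq]
    refine ⟨by omega, by omega, fun r hr c hc hpr hpc => ?_⟩
    rw [h.row p hp r hr] at hpr
    rw [h.col p hp c hc] at hpc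
    subst hpr hpc
    rw [h.getElem?_eq_endRow hp]
    constructor <;> intro he x hx <;> rw [h.row _ hq x hx, h.col _ hq x hx]
    · rw [(div_mod_succ_of_eq he).1, (div_mod_succ_of_eq he).2]
      refine ⟨Iff.rfl, fun hx0 => by omega, fun hx0 => ?_⟩
      have := hx0 0 (by omega)
      omega
    · rw [(div_mod_succ_of_ne he).1, (div_mod_succ_of_ne he).2]
      exact ⟨Iff.rfl, Iff.rfl⟩

end Represents

/-- A word in the right format represents a board. -/
theorem Format.represents {J : Type} {w : List Symbol} {T : Rels (Coord ⊕ J)} (h : Format w T) :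
    ∃ F : Frame J, Represents w T F := by
  obtain ⟨n, hn, h₁, h₂, h₃⟩ := h
  have key : ∀ p, p < w.length →
      (∀ x < w.length, (T (.inl .row) p x x = true ↔ x = p / (n + 1))) ∧
      (∀ x < w.length, (T (.inl .col) p x x = true ↔ x = p % (n + 1))) ∧
      (T (.inl .bit₀) p p p = true ↔ p % 2 = 1) ∧ (T (.inl .bit₁) p p p = true ↔ 2 ≤ p % 4) := by
    intro p
    induction p with
    | zero =>
      intro hp
      obtain ⟨h, h', h''⟩ := h₂ 0 hp (by simp)
      simp only [Nat.zero_div, Nat.zero_mod]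
      exact ⟨fun x hx => (h x hx).1, fun x hx => (h x hx).2, by simpa using h', by simpa using h''⟩
    | succ p ih =>
      intro hp
      obtain ⟨i₁, i₂, i₃, i₄⟩ := ih (by omega)
      have hr : p / (n + 1) < w.length := (Nat.div_le_self _ _).trans_lt (by omega)
      have hc : p % (n + 1) < w.length := (Nat.mod_le _ _).trans_lt (by omega)
      obtain ⟨j₁, j₂, j₃⟩ := h₃ p (by omega) (p + 1) hp rfl
      obtain ⟨j₄, j₅⟩ := j₃ _ hr _ hc ((i₁ _ hr).2 rfl) ((i₂ _ hc).2 rfl)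
      obtain ⟨k, -⟩ := h₁ p (by omega) _ hr _ hc ((i₁ _ hr).2 rfl) ((i₂ _ hc).2 rfl)
      refine and_assoc.1 ⟨?_, ?_, ?_⟩
      · rw [k] at j₄ j₅
        by_cases he : p % (n + 1) = n
        · rw [(div_mod_succ_of_eq he).1, (div_mod_succ_of_eq he).2]
          refine ⟨fun x hx => (j₄ he x hx).1, fun x hx => (j₄ he x hx).2.trans ⟨fun h0 => ?_, ?_⟩⟩
          · have := h0 0 (by omega)
            omega
          · rintro rfl y -
            omega
        · rw [(div_mod_succ_of_ne he).1, (div_mod_succ_of_ne he).2]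
          exact ⟨fun x hx => (j₅ he x hx).1, fun x hx => (j₅ he x hx).2⟩
      · rw [j₁, i₃]
        omega
      · rw [j₂, i₃, i₄]
        omega
  have key' : ∀ p, p < w.length → (w[p]? = some .endRow ↔ p % (n + 1) = n) ∧ p / (n + 1) < n ∧
      ((∀ q < w.length, q ≤ p) → n = p / (n + 1) + 1 ∧ p % (n + 1) = n) := by
    intro p hp
    obtain ⟨i₁, i₂, -⟩ := key p hp
    have hr : p / (n + 1) < w.length := (Nat.div_le_self _ _).trans_lt hp
    have hc : p % (n + 1) < w.length := (Nat.mod_le _ _).trans_lt hp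
    exact h₁ p hp _ hr _ hc ((i₁ _ hr).2 rfl) ((i₂ _ hc).2 rfl)
  have hlen : w.length = n * (n + 1) := by
    obtain ⟨h, h'⟩ := (key' (w.length - 1) (by omega)).2.2 fun q hq => by omega
    have e := Nat.div_add_mod (w.length - 1) (n + 1)
    obtain ⟨k, hk⟩ : ∃ k, k = (w.length - 1) / (n + 1) := ⟨_, rfl⟩
    rw [h', ← hk] at e
    rw [← hk] at h
    have : n * (n + 1) = (n + 1) * k + n + 1 := by
      rw [h]
      ring
    omega
  let b : Board n := fun s => match w[pos s]? with
    | some (.cell x) => x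
    | _ => none
  refine ⟨⟨n, b, fun j s t u => T (.inr j) (pos s) (pos t) (pos u)⟩, ?_,
    fun p hp => (key p hp).1, fun p hp => (key p hp).2.1, fun p hp => (key p hp).2.2.1,
    fun p hp => (key p hp).2.2.2, fun _ _ _ _ => rfl⟩
  refine List.ext_getElem? fun p => ?_
  by_cases hp : p < w.length
  · have hp' := hp
    rw [hlen] at hp'
    rw [getElem?_encodeBoard b hp']
    obtain ⟨k₁, k₂, -⟩ := key' p hp
    by_cases he : p % (n + 1) = n
    · rw [k₁.2 he, (symbolAt_eq_endRow b hp').2 he]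
    · have hlt := Nat.mod_lt p (by omega : n + 1 > 0)
      have hb : symbolAt b p = .cell (b (⟨p / (n + 1), k₂⟩, ⟨p % (n + 1), by omega⟩)) :=
        dif_pos ⟨k₂, by omega⟩
      have hpos : pos ((⟨p / (n + 1), k₂⟩, ⟨p % (n + 1), by omega⟩) : Square n) = p :=
        Nat.div_add_mod p (n + 1)
      rw [hb]
      simp only [b, hpos]
      rw [List.getElem?_eq_getElem hp] at k₁ ⊢
      rcases hx : w[p] with x | _
      · rfl
      · exact absurd (k₁.1 (by rw [hx])) he
  · have : (encodeBoard b).length ≤ p := by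
      rw [length_encodeBoard]
      omega
    rw [List.getElem?_eq_none (by omega), List.getElem?_eq_none this]

/-- Every frame is represented by a word with relations. -/
theorem exists_represents {J : Type} (F : Frame J) :
    ∃ T : Rels (Coord ⊕ J), Represents (encodeBoard F.b) T F := by
  classical
  refine ⟨fun k x y z => match k with
    | .inl .row => decide (y = x / (F.n + 1))
    | .inl .col => decide (y = x % (F.n + 1))
    | .inl .bit₀ => decide (x % 2 = 1)
    | .inl .bit₁ => decide (2 ≤ x % 4)
    | .inr j => decide (∃ s t u, pos s = x ∧ pos t = y ∧ pos u = z ∧ F.R j s t u = true),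
    rfl, by simp, by simp, by simp, by simp, fun j s t u => ?_⟩
  rw [Bool.eq_iff_iff, decide_eq_true_iff]
  constructor
  · rintro ⟨s', t', u', hs, ht, hu, h⟩
    rwa [pos_injective _ hs, pos_injective _ ht, pos_injective _ hu] at h
  · exact fun h => ⟨s, t, u, rfl, rfl, rfl, h⟩

/-! ### Definable predicates of squares -/

/-- A predicate of squares of a frame is definable if it is expressed by a first-order formula on the
positions of the squares. -/
def Def {J : Type} (d : ℕ) (P : (F : Frame J) → (Fin d → Square F.n) → Prop) : Prop :=
  ∃ φ : Fml Symbol (Coord ⊕ J) d, ∀ w T F, Represents w T F → ∀ v : Fin d → Square F.n,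
    (φ.Holds w T (fun i => pos (v i)) ↔ P F v)

/-- A square that depends on the values of variables is itself one of the variables. -/
def IsVar {J : Type} {d : ℕ} (t : (F : Frame J) → (Fin d → Square F.n) → Square F.n) : Prop :=
  ∃ i, ∀ F v, t F v = v i

section

variable {J : Type} {d : ℕ} {t t' t'' : (F : Frame J) → (Fin d → Square F.n) → Square F.n}

theorem IsVar.last : IsVar fun (F : Frame J) (v : Fin (d + 1) → Square F.n) => v (Fin.last d) :=
  ⟨_, fun _ _ => rfl⟩

theorem IsVar.init (ht : IsVar t) :
    IsVar fun (F : Frame J) (v : Fin (d + 1) → Square F.n) => t F (Fin.init v) :=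
  let ⟨i, hi⟩ := ht
  ⟨i.castSucc, fun F v => hi F (Fin.init v)⟩

namespace Def

variable {P Q : (F : Frame J) → (Fin d → Square F.n) → Prop}

theorem congr (hP : Def d P) (h : ∀ F v, P F v ↔ Q F v) : Def d Q :=
  let ⟨φ, hφ⟩ := hP
  ⟨φ, fun w T F hF v => (hφ w T F hF v).trans (h F v)⟩

theorem of_definable {P' : List Symbol → Rels (Coord ⊕ J) → (Fin d → ℕ) → Prop}
    (hP : Definable d P')
    (h : ∀ w T F, Represents w T F → ∀ v, P' w T (fun i => pos (v i)) ↔ P F v) : Def d P :=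
  let ⟨φ, hφ⟩ := hP
  ⟨φ, fun w T F hF v => (hφ w T _ fun i => hF.pos_lt (v i)).trans (h w T F hF v)⟩

theorem not (hP : Def d P) : Def d fun F v => ¬ P F v :=
  let ⟨φ, hφ⟩ := hP
  ⟨.not φ, fun w T F hF v => not_congr (hφ w T F hF v)⟩

theorem and (hP : Def d P) (hQ : Def d Q) : Def d fun F v => P F v ∧ Q F v :=
  let ⟨φ, hφ⟩ := hP
  let ⟨ψ, hψ⟩ := hQ
  ⟨.and φ ψ, fun w T F hF v => and_congr (hφ w T F hF v) (hψ w T F hF v)⟩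

theorem imp (hP : Def d P) (hQ : Def d Q) : Def d fun F v => P F v → Q F v :=
  (hP.and hQ.not).not.congr fun _ _ => by tauto

theorem or (hP : Def d P) (hQ : Def d Q) : Def d fun F v => P F v ∨ Q F v :=
  (hP.not.and hQ.not).not.congr fun _ _ => by tauto

theorem iff (hP : Def d P) (hQ : Def d Q) : Def d fun F v => P F v ↔ Q F v :=
  ((hP.imp hQ).and (hQ.imp hP)).congr fun _ _ => by tauto

theorem const (p : Prop) : Def d fun (_ : Frame J) _ => p := by
  by_cases hp : p
  · exact ⟨.verum, fun _ _ _ _ _ => by simp [Fml.Holds, hp]⟩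
  · exact ⟨.not .verum, fun _ _ _ _ _ => by simp [Fml.Holds, hp]⟩

theorem all {R : (F : Frame J) → (Fin d → Square F.n) → Square F.n → Prop}
    (hR : Def (d + 1) fun F v => R F (Fin.init v) (v (Fin.last d))) :
    Def d fun F v => ∀ x, R F v x := by
  obtain ⟨φ, hφ⟩ := hR
  -- the quantifier is restricted to the positions that are squares
  obtain ⟨ψ, hψ⟩ := (Definable.letter (J := Coord ⊕ J) Symbol.endRow (Fin.last d)).not
  refine ⟨.all (.not (.and ψ (.not φ))), fun w T F hF v => ?_⟩
  have hsnoc : ∀ s, (fun i => pos ((Fin.snoc v s : Fin (d + 1) → Square F.n) i)) =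
      (Fin.snoc (fun i => pos (v i)) (pos s) : Fin (d + 1) → ℕ) := by
    intro s
    funext i
    refine Fin.lastCases ?_ (fun i => ?_) i <;> simp
  have hφ' : ∀ s, φ.Holds w T (Fin.snoc (fun i => pos (v i)) (pos s)) ↔ R F v s := by
    intro s
    rw [← hsnoc, hφ w T F hF]
    simp
  have hψ' : ∀ x < w.length, ψ.Holds w T (Fin.snoc (fun i => pos (v i)) x) ↔
      ¬ w[x]? = some .endRow := by
    intro x hx
    rw [hψ w T _ fun i => ?_]
    · simp
    · refine Fin.lastCases ?_ (fun i => ?_) i <;> simp [hx, hF.pos_lt]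
  simp only [Fml.Holds, not_and, not_not]
  constructor
  · intro h s
    refine (hφ' s).1 (h _ (hF.pos_lt s) ((hψ' _ (hF.pos_lt s)).2 ?_))
    rw [hF.getElem?_pos]
    simp
  · intro h x hx hx'
    rw [hψ' x hx, hF.getElem?_eq_endRow hx] at hx'
    rw [hF.length] at hx
    have h₁ : x / (F.n + 1) < F.n := Nat.div_lt_of_lt_mul (by rwa [Nat.mul_comm])
    have h₂ := Nat.mod_lt x (by omega : F.n + 1 > 0)
    have := (hφ' (⟨_, h₁⟩, ⟨x % (F.n + 1), by omega⟩)).2 (h _)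
    rwa [pos, Nat.div_add_mod] at this

theorem ex {R : (F : Frame J) → (Fin d → Square F.n) → Square F.n → Prop}
    (hR : Def (d + 1) fun F v => R F (Fin.init v) (v (Fin.last d))) :
    Def d fun F v => ∃ x, R F v x :=
  (all (R := fun F v x => ¬ R F v x) hR.not).not.congr fun _ _ => by push Not; rfl

theorem finite_all {α : Type} [Finite α] {R : α → (F : Frame J) → (Fin d → Square F.n) → Prop}
    (hR : ∀ a, Def d (R a)) : Def d fun F v => ∀ a, R a F v := by
  have := Fintype.ofFinite α
  have h : ∀ s : Finset α, Def d fun F v => ∀ a ∈ s, R a F v := by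
    classical
    intro s
    induction s using Finset.induction_on with
    | empty => exact (const True).congr fun _ _ => by simp
    | insert a s _ ih => exact ((hR a).and ih).congr fun _ _ => by simp
  exact (h Finset.univ).congr fun _ _ => by simp

theorem finite_ex {α : Type} [Finite α] {R : α → (F : Frame J) → (Fin d → Square F.n) → Prop}
    (hR : ∀ a, Def d (R a)) : Def d fun F v => ∃ a, R a F v :=
  (finite_all fun a => (hR a).not).not.congr fun _ _ => by push Not; rfl

theorem rename {e : ℕ} (hP : Def d P) (g : Fin d → Fin e) :
    Def e fun F v => P F (v ∘ g) :=
  let ⟨φ, hφ⟩ := hP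
  ⟨φ.rename g, fun w T F hF _ => (φ.holds_rename w T g _).trans (hφ w T F hF _)⟩

theorem board (x : Option Piece) (ht : IsVar t) : Def d fun F v => F.b (t F v) = x := by
  obtain ⟨i, hi⟩ := ht
  refine of_definable (Definable.letter (.cell x) i) fun w T F hF v => ?_
  rw [hF.getElem?_pos, hi]
  simp

theorem rel (j : J) (ht : IsVar t) (ht' : IsVar t') (ht'' : IsVar t'') :
    Def d fun F v => F.R j (t F v) (t' F v) (t'' F v) = true := by
  obtain ⟨i, hi⟩ := ht
  obtain ⟨i', hi'⟩ := ht'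
  obtain ⟨i'', hi''⟩ := ht''
  refine of_definable (Definable.rel (.inr j) i i' i'') fun w T F hF v => ?_
  rw [hF.rel, hi, hi', hi'']

theorem eq (ht : IsVar t) (ht' : IsVar t') : Def d fun F v => t F v = t' F v := by
  obtain ⟨i, hi⟩ := ht
  obtain ⟨i', hi'⟩ := ht'
  refine of_definable (Definable.eq i i') fun w T F hF v => ?_
  rw [hi, hi', (pos_injective _).eq_iff]

end Def

end

end Checkers

/-! ### Captures -/

namespace Checkers

open Classical in
/-- The squares on which the opponent of `c` has a piece. -/
noncomputable def enemies {n : ℕ} (c : Color) (b : Board n) : Finset (Square n) :=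
  {m | ∃ y, b m = some y ∧ y.color ≠ c}

variable {n : ℕ}

theorem mem_enemies {c : Color} {b : Board n} {m : Square n} :
    m ∈ enemies c b ↔ ∃ y, b m = some y ∧ y.color ≠ c := by
  simp [enemies]

theorem enemies_red_eq_empty {b : Board n} : enemies .red b = ∅ ↔ NoPieces .black b := by
  simp only [Finset.eq_empty_iff_forall_notMem, mem_enemies, NoPieces]
  constructor
  · intro h s x hx hc
    exact h s ⟨x, hx, by simp [hc]⟩
  · rintro h s ⟨x, hx, hc⟩
    cases hx' : x.color
    · exact h s x hx hx'
    · exact hc hx'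

/-- The squares `u` and `m` are diagonal neighbours. -/
def Adj (u m : Square n) : Prop :=
  (m.1.val = u.1.val + 1 ∨ u.1.val = m.1.val + 1) ∧ (m.2.val = u.2.val + 1 ∨ u.2.val = m.2.val + 1)

theorem Piece.MayGo.cases {x : Piece} {d : ℤ × ℤ} (h : x.MayGo d) :
    (d.1 = 1 ∨ d.1 = -1) ∧ (d.2 = 1 ∨ d.2 = -1) := ⟨h.1, h.2.1⟩

theorem square_ext {s t : Square n} (h₁ : s.1.val = t.1.val) (h₂ : s.2.val = t.2.val) : s = t :=
  Prod.ext (Fin.ext h₁) (Fin.ext h₂)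

theorem IsShift.unique {s t t' : Square n} {k : ℤ} {d : ℤ × ℤ} (h : IsShift s k d t)
    (h' : IsShift s k d t') : t = t' := by
  obtain ⟨h₁, h₂⟩ := h
  obtain ⟨h₁', h₂'⟩ := h'
  exact square_ext (by omega) (by omega)

theorem IsShift.adj {s t : Square n} {d : ℤ × ℤ} (h : IsShift s 1 d t)
    (hd : (d.1 = 1 ∨ d.1 = -1) ∧ (d.2 = 1 ∨ d.2 = -1)) : Adj s t := by
  obtain ⟨h₁, h₂⟩ := h
  unfold Adj
  omega

theorem arrive_of_not_crowned {x : Piece} {t : Square n} (h : ¬ Crowned x t) : arrive x t = x :=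
  if_neg h

theorem arrive_color (x : Piece) (t : Square n) : (arrive x t).color = x.color := by
  unfold arrive
  split_ifs <;> rfl

/-- What a jump changes. -/
theorem Jump.effect {b b' : Board n} {s t : Square n} {x : Piece} (h : Jump b s x t b') :
    ∃ (d : ℤ × ℤ) (m : Square n), x.MayGo d ∧ IsShift s 1 d m ∧ IsShift s 2 d t ∧
      m ∈ enemies x.color b ∧ b t = none ∧ b s = some x ∧ b' t = some (arrive x t) ∧
      b' m = none ∧ b' s = none ∧ (∀ v, v ≠ s → v ≠ m → v ≠ t → b' v = b v) ∧
      enemies x.color b' = (enemies x.color b).erase m := by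
  obtain ⟨hs, d, m, y, hgo, hm, ht, hy, hc, hbt, rfl⟩ := h
  have hd := hgo.cases
  have hms : m ≠ s := by
    rintro rfl
    obtain ⟨h₁, h₂⟩ := hm
    omega
  have hmt : m ≠ t := by
    rintro rfl
    simp [hbt] at hy
  have hst : s ≠ t := by
    rintro rfl
    simp [hbt] at hs
  refine ⟨d, m, hgo, hm, ht, mem_enemies.2 ⟨y, hy, hc⟩, hbt, hs, by simp, by simp [hmt],
    by simp [hst, hms.symm], fun v h₁ h₂ h₃ => by simp [h₁, h₂, h₃], ?_⟩
  ext v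
  rw [Finset.mem_erase, mem_enemies, mem_enemies]
  by_cases hvt : v = t
  · subst hvt
    simp [hbt, arrive_color]
  by_cases hvm : v = m
  · subst hvm
    simp [hmt]
  by_cases hvs : v = s
  · subst hvs
    simp [hst, hms.symm, hs]
  simp [hvt, hvm, hvs]

theorem exists_jump {b : Board n} {s m t : Square n} {x : Piece} {d : ℤ × ℤ} (hs : b s = some x)
    (hgo : x.MayGo d) (hm : IsShift s 1 d m) (ht : IsShift s 2 d t) (hme : m ∈ enemies x.color b)
    (hbt : b t = none) :
    ∃ b', Jump b s x t b' ∧ enemies x.color b' = (enemies x.color b).erase m := by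
  obtain ⟨y, hy, hc⟩ := mem_enemies.1 hme
  refine ⟨_, ⟨hs, d, m, y, hgo, hm, ht, hy, hc, hbt, rfl⟩, ?_⟩
  obtain ⟨d', m', hgo', hm', ht', -, -, -, -, -, -, -, he⟩ :=
    Jump.effect ⟨hs, d, m, y, hgo, hm, ht, hy, hc, hbt, rfl⟩
  have : m' = m := by
    obtain ⟨h₁, h₂⟩ := hm
    obtain ⟨h₃, h₄⟩ := ht
    obtain ⟨h₅, h₆⟩ := hm'
    obtain ⟨h₇, h₈⟩ := ht'
    exact square_ext (by omega) (by omega)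
  rw [he, this]

/-- A complete capturing move of the piece `x` on `s` that ends on `t`. -/
inductive CaptureTo : Board n → Square n → Piece → Square n → Board n → Prop
  | last {b : Board n} {s : Square n} {x : Piece} {t : Square n} {b' : Board n} :
      Jump b s x t b' → (Crowned x t ∨ ¬ CanJump b' t) → CaptureTo b s x t b'
  | more {b : Board n} {s : Square n} {x : Piece} {t u : Square n} {b₁ b' : Board n} :
      Jump b s x t b₁ → ¬ Crowned x t → CaptureTo b₁ t x u b' → CaptureTo b s x u b'

theorem captureMove_iff {b b' : Board n} {s : Square n} {x : Piece} :
    CaptureMove b s x b' ↔ ∃ t, CaptureTo b s x t b' := by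
  constructor
  · intro h
    induction h with
    | last hj he => exact ⟨_, .last hj he⟩
    | more hj hc _ ih =>
      obtain ⟨u, hu⟩ := ih
      exact ⟨u, .more hj hc hu⟩
  · rintro ⟨t, h⟩
    induction h with
    | last hj he => exact .last hj he
    | more hj hc _ ih => exact .more hj hc ih

theorem CaptureMove.canJump {b b' : Board n} {s : Square n} {x : Piece}
    (h : CaptureMove b s x b') : CanJump b s := by
  cases h with
  | last hj _ => exact ⟨_, _, _, hj⟩
  | more hj _ _ => exact ⟨_, _, _, hj⟩

theorem CaptureMove.piece {b b' : Board n} {s : Square n} {x : Piece}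
    (h : CaptureMove b s x b') : b s = some x := by
  cases h with
  | last hj _ => exact hj.1
  | more hj _ _ => exact hj.1

theorem Jump.card_enemies_lt {b b' : Board n} {s t : Square n} {x : Piece}
    (h : Jump b s x t b') : (enemies x.color b').card < (enemies x.color b).card := by
  obtain ⟨d, m, -, -, -, hm, -, -, -, -, -, -, he⟩ := h.effect
  rw [he]
  exact Finset.card_erase_lt_of_mem hm

/-- A piece that can jump has a complete capturing move, since every jump removes a piece. -/
theorem exists_captureMove {b : Board n} {s : Square n} {x : Piece} (hs : b s = some x)
    (h : CanJump b s) : ∃ b', CaptureMove b s x b' := by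
  induction hk : (enemies x.color b).card using Nat.strong_induction_on generalizing b s with
  | _ k ih =>
    obtain ⟨x', t, b₁, hj⟩ := h
    obtain rfl : x' = x := by
      have := hj.1
      rw [hs] at this
      exact (Option.some_inj.1 this).symm
    by_cases hc : Crowned x' t ∨ ¬ CanJump b₁ t
    · exact ⟨b₁, .last hj hc⟩
    · rw [not_or, not_not] at hc
      obtain ⟨-, -, -, -, -, -, -, -, ht, -⟩ := hj.effect
      rw [arrive_of_not_crowned hc.1] at ht
      obtain ⟨b', hb'⟩ := ih _ (hk ▸ hj.card_enemies_lt) ht hc.2 rfl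
      exact ⟨b', .more hj hc.1 hb'⟩

/-- After a capturing move the moving player has a piece on the board. -/
theorem CaptureMove.exists_piece {b b' : Board n} {s : Square n} {x : Piece}
    (h : CaptureMove b s x b') : ∃ t y, b' t = some y ∧ y.color = x.color := by
  induction h with
  | last hj _ =>
    obtain ⟨-, -, -, -, -, -, -, -, ht, -⟩ := hj.effect
    exact ⟨_, _, ht, arrive_color _ _⟩
  | more _ _ _ ih => exact ih

/-! ### Capturing moves of men -/

/-- A man does not capture pieces that are not ahead of it. -/
theorem CaptureMove.enemy_behind {b b' : Board n} {s : Square n} {x : Piece}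
    (h : CaptureMove b s x b') (hx : x.king = false) {m : Square n} {y : Piece}
    (hm : b m = some y) (hc : y.color ≠ x.color)
    (hb : ((m.1.val : ℤ) - s.1.val) * x.color.forward ≤ 0) : b' m = some y := by
  have key : ∀ {b b' : Board n} {s t : Square n}, Jump b s x t b' → b m = some y →
      ((m.1.val : ℤ) - s.1.val) * x.color.forward ≤ 0 →
      b' m = some y ∧ ((m.1.val : ℤ) - t.1.val) * x.color.forward ≤ 0 := by
    intro b b' s t hj hm hb
    obtain ⟨d, m', ⟨-, -, hgo⟩, hm', ht, -, hbt, hs, -, -, -, hrest, -⟩ := hj.effect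
    simp only [hx, Bool.false_eq_true, false_or] at hgo
    obtain ⟨h₁, -⟩ := hm'
    obtain ⟨h₂, -⟩ := ht
    rw [hgo] at h₁ h₂
    refine ⟨?_, ?_⟩
    · rw [hrest m, hm]
      · rintro rfl
        rw [hm] at hs
        exact hc (by rw [Option.some_inj.1 hs])
      · rintro rfl
        cases hf : x.color <;> rw [hf] at h₁ hb <;> simp only [Color.forward] at h₁ hb <;> omega
      · rintro rfl
        rw [hm] at hbt
        cases hbt
    · cases hf : x.color <;> rw [hf] at h₂ hb <;> simp only [Color.forward] at h₂ hb ⊢ <;> omega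
  induction h with
  | last hj _ => exact (key hj hm hb).1
  | more hj _ _ ih =>
    obtain ⟨h₁, h₂⟩ := key hj hm hb
    exact ih hx h₁ hc h₂ (fun hj h h' => key hj h h')

/-- If some capturing move of a man takes all enemies, then these stand on different rows, so that
the man has no choice. -/
theorem CaptureMove.eq_of_man {b b' b'' : Board n} {s : Square n} {x : Piece}
    (h : CaptureMove b s x b') (hx : x.king = false) (he : enemies x.color b' = ∅)
    (h' : CaptureMove b s x b'') : b'' = b' := by
  -- two jumps with which the move can begin are equal
  have key : ∀ {b b₁ b₂ b' : Board n} {s t₁ t₂ : Square n}, enemies x.color b' = ∅ →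
      Jump b s x t₁ b₁ → (b' = b₁ ∨ CaptureMove b₁ t₁ x b') → Jump b s x t₂ b₂ →
      t₂ = t₁ ∧ b₂ = b₁ := by
    intro b b₁ b₂ b' s t₁ t₂ he h₁ h h₂
    obtain ⟨e₁, m₁, -, hm₁, ht₁, -, hbt₁, hs₁, -, -, -, hrest₁, -⟩ := h₁.effect
    obtain ⟨-, d₁, n₁, y₁, hgo₁, hn₁, hu₁, -, -, -, rfl⟩ := h₁
    obtain ⟨hs, d₂, n₂, y₂, hgo₂, hn₂, hu₂, hy₂, hc₂, hbt₂, rfl⟩ := h₂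
    have hd₁ := hgo₁.cases
    have hd₂ := hgo₂.cases
    have hf₁ := hgo₁.2.2
    have hf₂ := hgo₂.2.2
    simp only [hx, Bool.false_eq_true, false_or] at hf₁ hf₂
    by_cases hd : d₁.2 = d₂.2
    · obtain rfl : d₁ = d₂ := Prod.ext (hf₁.trans hf₂.symm) hd
      obtain rfl := hn₁.unique hn₂
      obtain rfl := hu₁.unique hu₂
      exact ⟨rfl, rfl⟩
    · exfalso
      obtain ⟨a₁, a₂⟩ := hn₁
      obtain ⟨a₃, a₄⟩ := hu₁
      obtain ⟨a₅, a₆⟩ := hn₂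
      obtain ⟨a₇, a₈⟩ := hm₁
      obtain ⟨a₉, a₁₀⟩ := ht₁
      have hn : ∀ b₁ : Board n, (∀ v, v ≠ s → v ≠ m₁ → v ≠ t₁ → b₁ v = b v) →
          b₁ n₂ = some y₂ := by
        intro b₁ hr
        rw [hr n₂, hy₂]
        · rintro rfl
          omega
        · rintro rfl
          omega
        · rintro rfl
          omega
      have hn' := hn _ hrest₁
      have hend : b' n₂ = some y₂ := by
        rcases h with rfl | h
        · exact hn'
        · refine h.enemy_behind hx hn' hc₂ ?_
          rw [hf₁] at a₃
          rw [hf₂] at a₅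
          cases hf : x.color <;> rw [hf] at a₃ a₅ <;> simp only [Color.forward] at a₃ a₅ ⊢ <;>
            omega
      have : n₂ ∈ enemies x.color b' := mem_enemies.2 ⟨y₂, hend, hc₂⟩
      simp [he] at this
  induction h with
  | last hj hl =>
    cases h' with
    | last hj' _ => exact (key he hj (.inl rfl) hj').2
    | more hj' hc' h' =>
      obtain ⟨rfl, rfl⟩ := key he hj (.inl rfl) hj'
      exact (hl.elim hc' fun h => h h'.canJump).elim
  | more hj hc h ih =>
    cases h' with
    | last hj' hl' =>
      obtain ⟨rfl, rfl⟩ := key he hj (.inr h) hj'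
      exact (hl'.elim hc fun h' => h' h.canJump).elim
    | more hj' _ h' =>
      obtain ⟨rfl, rfl⟩ := key he hj (.inr h) hj'
      exact ih hx he h' (fun h1 h2 h3 h4 => key h1 h2 h3 h4)

end Checkers

/-! ### Capturing moves of kings as trails in a graph -/

namespace Checkers

open Relation

variable {n : ℕ}

/-- The squares that a king on `s` could reach by jumps, as far as their coordinates are concerned:
the lattice spanned by the vectors `(±2, ±2)`, shifted to `s`. -/
def SameClass (s u : Square n) : Prop :=
  (u.1.val + s.1.val) % 2 = 0 ∧ (u.1.val + u.2.val + 3 * (s.1.val + s.2.val)) % 4 = 0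

theorem SameClass.refl (s : Square n) : SameClass s s := by
  unfold SameClass
  omega

theorem SameClass.opposite {s u v m : Square n} (hu : SameClass s u) (hv : SameClass s v)
    (hum : Adj u m) (hvm : Adj v m) (huv : u ≠ v) :
    u.1.val + v.1.val = 2 * m.1.val ∧ u.2.val + v.2.val = 2 * m.2.val := by
  have : ¬ (u.1.val = v.1.val ∧ u.2.val = v.2.val) := fun h => huv (square_ext h.1 h.2)
  unfold SameClass at hu hv
  unfold Adj at hum hvm
  omega

theorem SameClass.eq_or_eq {s u v w m : Square n} (hu : SameClass s u) (hv : SameClass s v)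
    (hw : SameClass s w) (hum : Adj u m) (hvm : Adj v m) (hwm : Adj w m) (huv : u ≠ v) :
    w = u ∨ w = v := by
  by_contra! h
  have h₁ := hu.opposite hv hum hvm huv
  have h₂ := hw.opposite hu hwm hum h.1
  exact h.2 (square_ext (by omega) (by omega))

theorem SameClass.not_adj {s u m : Square n} (hu : SameClass s u) (hum : Adj u m) :
    ¬ SameClass s m := by
  unfold SameClass at hu ⊢
  unfold Adj at hum
  omega

theorem SameClass.jump {s u m v : Square n} {d : ℤ × ℤ} (hu : SameClass s u)
    (hd : (d.1 = 1 ∨ d.1 = -1) ∧ (d.2 = 1 ∨ d.2 = -1)) (hm : IsShift u 1 d m)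
    (hv : IsShift u 2 d v) : SameClass s v ∧ Adj u m ∧ Adj v m ∧ u ≠ v := by
  obtain ⟨h₁, h₂⟩ := hm
  obtain ⟨h₃, h₄⟩ := hv
  refine ⟨?_, ?_, ?_, ?_⟩
  · unfold SameClass at hu ⊢
    omega
  · unfold Adj
    omega
  · unfold Adj
    omega
  · rintro rfl
    omega

/-- The square `m` is the midpoint of two squares that a king starting on `s` could reach and that
are vacant once the king has left `s`: the enemy on `m` is an edge joining these two. -/
def IsEdge (b : Board n) (s m : Square n) : Prop :=
  ∃ u v, SameClass s u ∧ SameClass s v ∧ Adj u m ∧ Adj v m ∧ u ≠ v ∧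
    Function.update b s none u = none ∧ Function.update b s none v = none

open Classical in
/-- The incidence matrix, over the field of two elements, of the graph whose vertices are the
squares in the class of `s` and whose edges are the squares between them. -/
noncomputable def inc (s v m : Square n) : ZMod 2 :=
  if SameClass s v ∧ Adj v m then 1 else 0

/-- The degrees modulo `2` of the graph with the set of edges `H`. -/
noncomputable def deg (s : Square n) (H : Finset (Square n)) (v : Square n) : ZMod 2 :=
  ∑ m ∈ H, inc s v m

theorem inc_eq {s u v m : Square n} (hu : SameClass s u) (hv : SameClass s v) (hum : Adj u m)
    (hvm : Adj v m) (huv : u ≠ v) (w : Square n) :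
    inc s w m = (if w = u then 1 else 0) + if w = v then 1 else 0 := by
  unfold inc
  by_cases h₁ : w = u
  · subst h₁
    simp [hu, hum, huv]
  by_cases h₂ : w = v
  · subst h₂
    simp [hv, hvm, h₁]
  rw [if_neg, if_neg h₁, if_neg h₂, add_zero]
  rintro ⟨h, h'⟩
  rcases hu.eq_or_eq hv h hum hvm h' huv with h | h
  exacts [h₁ h, h₂ h]

theorem sum_inc_mul {s u v m : Square n} (hu : SameClass s u) (hv : SameClass s v) (hum : Adj u m)
    (hvm : Adj v m) (huv : u ≠ v) (ψ : Square n → ZMod 2) :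
    ∑ w, inc s w m * ψ w = ψ u + ψ v := by
  simp [inc_eq hu hv hum hvm huv, add_mul, Finset.sum_add_distrib]

/-- One jump of the piece `x`, as a step from a board and the square of `x` to the next. -/
def JumpStep (x : Piece) (p q : Board n × Square n) : Prop := Jump p.1 p.2 x q.2 q.1

theorem not_crowned_of_king {x : Piece} (hx : x.king = true) (t : Square n) : ¬ Crowned x t := by
  simp [Crowned, hx]

theorem CaptureTo.reflTransGen {b b' : Board n} {s t : Square n} {x : Piece}
    (h : CaptureTo b s x t b') (hx : x.king = true) :
    ReflTransGen (JumpStep x) (b, s) (b', t) ∧ ¬ CanJump b' t := by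
  induction h with
  | @last b s x t b' hj hl =>
    exact ⟨.single (show JumpStep x (b, s) (b', t) from hj),
      hl.resolve_left (not_crowned_of_king hx _)⟩
  | @more b s x t u b₁ b' hj hc _ ih =>
    obtain ⟨h₁, h₂⟩ := ih hx
    exact ⟨.head (show JumpStep x (b, s) (b₁, t) from hj) h₁, h₂⟩

theorem captureTo_of_reflTransGen {b b' : Board n} {s t : Square n} {x : Piece}
    (hx : x.king = true) (h : ReflTransGen (JumpStep x) (b, s) (b', t)) (hs : CanJump b s)
    (ht : ¬ CanJump b' t) : CaptureTo b s x t b' := by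
  have key : ∀ p, ReflTransGen (JumpStep x) p (b', t) → CanJump p.1 p.2 →
      CaptureTo p.1 p.2 x t b' := by
    intro p hp
    induction hp using ReflTransGen.head_induction_on with
    | refl => exact fun h => (ht h).elim
    | @head p q hpq hq ih =>
      intro _
      by_cases hc : CanJump q.1 q.2
      · exact .more hpq (not_crowned_of_king hx _) (ih hc)
      · rcases hq.cases_head with h | ⟨r, hr, -⟩
        · subst h
          exact .last hpq (.inr ht)
        · exact (hc ⟨_, _, _, hr⟩).elim
  exact key _ h hs

/-- What is preserved while the king `x` jumps from `s` to `p`, turning `b` into `B`. Every jump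
removes the edge that the king runs along, so the parity of the degree changes at the two ends
only. -/
structure Invariant (b : Board n) (s : Square n) (x : Piece) (B : Board n) (p : Square n) :
    Prop where
  king : B p = some x
  sameClass : SameClass s p
  vacant : Function.update b s none p = none
  unchanged : ∀ u, SameClass s u → u ≠ p → B u = Function.update b s none u
  subset : enemies x.color B ⊆ enemies x.color b
  isEdge : ∀ m ∈ enemies x.color b, m ∉ enemies x.color B → IsEdge b s m
  parity : ∀ v, deg s (enemies x.color B) v + (if v = p then 1 else 0) =
    deg s (enemies x.color b) v + if v = s then 1 else 0

theorem deg_erase {s m v : Square n} {H : Finset (Square n)} (hm : m ∈ H) :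
    deg s (H.erase m) v + inc s v m = deg s H v :=
  Finset.sum_erase_add _ _ hm

theorem Invariant.refl {b : Board n} {s : Square n} {x : Piece} (h : b s = some x) :
    Invariant b s x b s where
  king := h
  sameClass := .refl s
  vacant := by simp
  unchanged u _ hu := by simp [hu]
  subset := subset_rfl
  isEdge m h h' := (h' h).elim
  parity _ := rfl

theorem Invariant.step {b B B' : Board n} {s p q : Square n} {x : Piece} (hx : x.king = true)
    (h : Invariant b s x B p) (hj : Jump B p x q B') : Invariant b s x B' q := by
  obtain ⟨d, m, hgo, hm, hq, hme, hBq, hBp, hB'q, hB'm, hB'p, hrest, he⟩ := hj.effect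
  obtain ⟨hLq, hpm, hqm, hpq⟩ := h.sameClass.jump hgo.cases hm hq
  have hvq : Function.update b s none q = none := by
    rw [← h.unchanged q hLq hpq.symm, hBq]
  refine ⟨?_, hLq, hvq, ?_, ?_, ?_, ?_⟩
  · rw [hB'q, arrive_of_not_crowned (not_crowned_of_king hx q)]
  · intro u hu huq
    by_cases hup : u = p
    · rw [hup, hB'p, h.vacant]
    · rw [hrest u hup _ huq, h.unchanged u hu hup]
      rintro rfl
      exact h.sameClass.not_adj hpm hu
  · rw [he]
    exact (Finset.erase_subset _ _).trans h.subset
  · intro m' hm' hm''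
    by_cases hmm : m' = m
    · rw [hmm]
      exact ⟨p, q, h.sameClass, hLq, hpm, hqm, hpq, h.vacant, hvq⟩
    · refine h.isEdge m' hm' fun h => hm'' ?_
      rw [he]
      exact Finset.mem_erase.2 ⟨hmm, h⟩
  · intro v
    have h₁ := h.parity v
    have h₂ := deg_erase (s := s) (v := v) hme
    rw [inc_eq h.sameClass hLq hpm hqm hpq] at h₂
    have h₃ : ∀ a : ZMod 2, a + a = 0 := CharTwo.add_self_eq_zero
    rw [he, ← h₁, ← h₂]
    linear_combination - h₃ (if v = p then 1 else 0)

theorem Invariant.of_reflTransGen {b B : Board n} {s p : Square n} {x : Piece}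
    (hx : x.king = true) (hs : b s = some x) (h : ReflTransGen (JumpStep x) (b, s) (B, p)) :
    Invariant b s x B p := by
  have key : ∀ q, ReflTransGen (JumpStep x) (b, s) q → Invariant b s x q.1 q.2 := by
    intro q hq
    induction hq with
    | refl => exact .refl hs
    | tail _ h ih => exact ih.step hx h
  exact key _ h

/-- While an edge at its square is left, the king can run along that edge. -/
theorem Invariant.exists_jump {b B : Board n} {s p m : Square n} {x : Piece} (hx : x.king = true)
    (h : Invariant b s x B p) (hm : m ∈ enemies x.color B) (he : IsEdge b s m) (hpm : Adj p m) :
    ∃ q B', Jump B p x q B' ∧ enemies x.color B' = (enemies x.color B).erase m := by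
  have key : ∀ v, SameClass s v → Adj v m → p ≠ v → Function.update b s none v = none →
      ∃ q B', Jump B p x q B' ∧ enemies x.color B' = (enemies x.color B).erase m := by
    intro v hv hvm hpv hbv
    have hopp := h.sameClass.opposite hv hpm hvm hpv
    unfold Adj at hpm
    refine ⟨v, Checkers.exists_jump (d := ((m.1.val : ℤ) - p.1.val, (m.2.val : ℤ) - p.2.val)) h.king
      ⟨?_, ?_, .inl hx⟩ ?_ ?_ hm (by rw [h.unchanged v hv hpv.symm, hbv])⟩
    · dsimp only
      omega
    · dsimp only
      omega
    · constructor <;> dsimp only <;> omega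
    · constructor <;> dsimp only <;> omega
  obtain ⟨u, v, hu, hv, hum, hvm, huv, hbu, hbv⟩ := he
  rcases hu.eq_or_eq hv h.sameClass hum hvm hpm huv with hp | hp
  · exact key v hv hvm (hp ▸ huv) hbv
  · exact key u hu hum (hp ▸ huv.symm) hbu

theorem Invariant.not_adj {b B : Board n} {s p m : Square n} {x : Piece} (hx : x.king = true)
    (h : Invariant b s x B p) (hE : ∀ m ∈ enemies x.color b, IsEdge b s m) (hp : ¬ CanJump B p)
    (hm : m ∈ enemies x.color B) : ¬ Adj p m := by
  intro hpm
  obtain ⟨q, B', hj, -⟩ := h.exists_jump hx hm (hE m (h.subset hm)) hpm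
  exact hp ⟨_, _, _, hj⟩

/-- The function `φ` describes a cut of the graph without the edges at `t`, and `e` is the only
edge of the cut. -/
def IsBridgeCut (c : Color) (b : Board n) (s t e : Square n) (φ : Square n → Bool) : Prop :=
  ∀ m ∈ enemies c b, ¬ Adj t m → ∀ u v, SameClass s u → SameClass s v → Adj u m → Adj v m →
    u ≠ v → (φ u = φ v ↔ m ≠ e)

theorem deg_eq_zero_of_forall_not_adj {s v : Square n} {H : Finset (Square n)}
    (h : ∀ m ∈ H, ¬ Adj v m) : deg s H v = 0 :=
  Finset.sum_eq_zero fun m hm => if_neg fun h' => h m hm h'.2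

/-- If one capturing move of a king takes all enemies and ends on `t`, and all edges that avoid `t`
are bridges once the edges at `t` are removed, then every capturing move takes all enemies: by
parity it also ends on `t`, and the edges that it leaves form a graph with even degrees that avoids
`t`, so it cannot meet a cut in a single edge. -/
theorem enemies_eq_empty_of_isBridgeCut {b b' b'' : Board n} {s t : Square n} {x : Piece}
    (hx : x.king = true) (h : CaptureTo b s x t b') (he : enemies x.color b' = ∅)
    (hφ : ∀ e ∈ enemies x.color b, ¬ Adj t e → ∃ φ, IsBridgeCut x.color b s t e φ)
    (h' : CaptureMove b s x b'') : enemies x.color b'' = ∅ := by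
  have hs := h'.piece
  obtain ⟨p, h'⟩ := captureMove_iff.1 h'
  obtain ⟨h₁, -⟩ := h.reflTransGen hx
  obtain ⟨h₂, hp⟩ := h'.reflTransGen hx
  have i₁ := Invariant.of_reflTransGen hx hs h₁
  have i₂ := Invariant.of_reflTransGen hx hs h₂
  have hE : ∀ m ∈ enemies x.color b, IsEdge b s m := fun m hm => i₁.isEdge m hm (by simp [he])
  have hpar : ∀ v, deg s (enemies x.color b'') v + (if v = p then 1 else 0) =
      if v = t then 1 else 0 := by
    intro v
    rw [i₂.parity, ← i₁.parity, he]
    simp [deg]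
  have hadj : ∀ m ∈ enemies x.color b'', ¬ Adj p m := fun m hm => i₂.not_adj hx hE hp hm
  have hpt : p = t := by
    by_contra hne
    have := hpar p
    rw [deg_eq_zero_of_forall_not_adj hadj] at this
    simp [hne] at this
  subst hpt
  have hdeg : ∀ v, deg s (enemies x.color b'') v = 0 := by
    intro v
    have := hpar v
    simpa using this
  by_contra hne
  obtain ⟨e, heb⟩ := Finset.nonempty_iff_ne_empty.2 hne
  obtain ⟨φ, hφ⟩ := hφ e (i₂.subset heb) (hadj e heb)
  let ψ : Square n → ZMod 2 := fun v => if φ v then 1 else 0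
  have hzero : ∑ m ∈ enemies x.color b'', ∑ w, inc s w m * ψ w = 0 := by
    rw [Finset.sum_comm]
    refine Finset.sum_eq_zero fun w _ => ?_
    rw [← Finset.sum_mul]
    exact mul_eq_zero_of_left (hdeg w) _
  have hone : ∀ m ∈ enemies x.color b'', ∑ w, inc s w m * ψ w = if m = e then 1 else 0 := by
    intro m hm
    obtain ⟨u, v, hu, hv, hum, hvm, huv, -, -⟩ := hE m (i₂.subset hm)
    have := hφ m (i₂.subset hm) (hadj m hm) u v hu hv hum hvm huv
    rw [sum_inc_mul hu hv hum hvm huv]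
    by_cases hme : m = e
    · rw [if_pos hme]
      cases hu : φ u <;> cases hv : φ v <;> simp_all [ψ]
    · rw [if_neg hme]
      have h₃ : φ u = φ v := this.2 hme
      simp only [ψ, h₃]
      exact CharTwo.add_self_eq_zero _
  rw [Finset.sum_congr rfl hone] at hzero
  simp [heb] at hzero

/-- A set of edges `H` with even degrees can be left over: a king that avoids `H` as long as it can
stops only where no edges other than those in `H` are left. -/
theorem Invariant.exists_avoiding {b B : Board n} {s p : Square n} {x : Piece} (hx : x.king = true)
    (h : Invariant b s x B p) (hE : ∀ m ∈ enemies x.color b, IsEdge b s m)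
    {H : Finset (Square n)} (hH : H ⊆ enemies x.color B) :
    ∃ B' q, ReflTransGen (JumpStep x) (B, p) (B', q) ∧ H ⊆ enemies x.color B' ∧
      ∀ m ∈ enemies x.color B', m ∉ H → ¬ Adj q m := by
  induction hk : (enemies x.color B).card using Nat.strong_induction_on generalizing B p with
  | _ k ih =>
    by_cases hdone : ∀ m ∈ enemies x.color B, m ∉ H → ¬ Adj p m
    · exact ⟨B, p, .refl, hH, hdone⟩
    · push Not at hdone
      obtain ⟨m, hm, hmH, hpm⟩ := hdone
      obtain ⟨q, B₁, hj, he⟩ := h.exists_jump hx hm (hE m (h.subset hm)) hpm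
      obtain ⟨B', q', h₁, h₂, h₃⟩ := ih _ (hk ▸ hj.card_enemies_lt) (h.step hx hj)
        (by rw [he]; exact Finset.subset_erase.2 ⟨hH, hmH⟩) rfl
      exact ⟨B', q', .head (show JumpStep x (B, p) (B₁, q) from hj) h₁, h₂, h₃⟩

/-- A consequence of the duality between cuts and cycles: an edge `e` of `E` is the only edge of
some cut, or it lies in a set of edges with even degrees. -/
theorem exists_cut_or_exists_even (s : Square n) {E : Finset (Square n)} {e : Square n}
    (he : e ∈ E) :
    (∃ ψ : Square n → ZMod 2, ∀ m ∈ E, ∑ w, inc s w m * ψ w = if m = e then 1 else 0) ∨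
      ∃ H ⊆ E, e ∈ H ∧ ∀ v, deg s H v = 0 := by
  classical
  let A : (Square n → ZMod 2) →ₗ[ZMod 2] (Square n → ZMod 2) :=
    { toFun := fun ψ m => if m ∈ E then ∑ w, inc s w m * ψ w else 0
      map_add' := by
        intro ψ ψ'
        ext m
        by_cases hm : m ∈ E <;> simp [hm, mul_add, Finset.sum_add_distrib]
      map_smul' := by
        intro a ψ
        ext m
        by_cases hm : m ∈ E <;> simp [hm, Finset.mul_sum, mul_left_comm] }
  by_cases hr : Pi.single e 1 ∈ LinearMap.range A
  · left
    obtain ⟨ψ, hψ⟩ := hr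
    refine ⟨ψ, fun m hm => ?_⟩
    have := congrFun hψ m
    simpa [A, hm, Pi.single_apply] using this
  · right
    obtain ⟨f, hf, hf'⟩ := Submodule.exists_dual_map_eq_bot_of_notMem hr inferInstance
    have hfA : ∀ ψ, f (A ψ) = 0 := by
      intro ψ
      have : f (A ψ) ∈ (LinearMap.range A).map f := ⟨_, ⟨ψ, rfl⟩, rfl⟩
      rwa [hf', Submodule.mem_bot] at this
    refine ⟨E.filter fun m => f (Pi.single m 1) ≠ 0, Finset.filter_subset _ _,
      Finset.mem_filter.2 ⟨he, hf⟩, fun v => ?_⟩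
    have hA : A (Pi.single v 1) = ∑ m ∈ E, inc s v m • Pi.single m (1 : ZMod 2) := by
      ext m
      simp [A, Pi.single_apply, Finset.sum_apply]
    have hA₀ := hfA (Pi.single v 1)
    rw [hA, map_sum] at hA₀
    rw [deg, Finset.sum_filter]
    refine (Finset.sum_congr rfl fun m _ => ?_).trans hA₀
    rw [map_smul, smul_eq_mul]
    have h₂ : ∀ a : ZMod 2, a = 0 ∨ a = 1 := by decide
    rcases h₂ (f (Pi.single m 1)) with h | h <;> simp [h]

/-- The converse of `enemies_eq_empty_of_isBridgeCut`. -/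
theorem exists_isBridgeCut {b b' : Board n} {s t e : Square n} {x : Piece} (hx : x.king = true)
    (h : CaptureTo b s x t b') (hall : ∀ b'', CaptureMove b s x b'' → enemies x.color b'' = ∅)
    (he : e ∈ enemies x.color b) (hte : ¬ Adj t e) : ∃ φ, IsBridgeCut x.color b s t e φ := by
  have hm := captureMove_iff.2 ⟨t, h⟩
  have hs := hm.piece
  have he' := hall _ hm
  obtain ⟨h₁, -⟩ := h.reflTransGen hx
  have i₁ := Invariant.of_reflTransGen hx hs h₁
  have hE : ∀ m ∈ enemies x.color b, IsEdge b s m := fun m hm => i₁.isEdge m hm (by simp [he'])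
  classical
  rcases exists_cut_or_exists_even s (E := (enemies x.color b).filter fun m => ¬ Adj t m)
    (Finset.mem_filter.2 ⟨he, hte⟩) with ⟨ψ, hψ⟩ | ⟨H, hH, heH, hdeg⟩
  · refine ⟨fun v => decide (ψ v = 1), fun m hm htm u v hu hv hum hvm huv => ?_⟩
    have := hψ m (Finset.mem_filter.2 ⟨hm, htm⟩)
    rw [sum_inc_mul hu hv hum hvm huv] at this
    have key : ∀ a b : ZMod 2, (a + b = 1 → ¬ (a = 1 ↔ b = 1)) ∧ (a + b = 0 → (a = 1 ↔ b = 1)) := by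
      decide
    by_cases hme : m = e
    · rw [if_pos hme] at this
      simpa [hme] using (key _ _).1 this
    · rw [if_neg hme] at this
      simpa [hme] using (key _ _).2 this
  · exfalso
    obtain ⟨B, p, h₂, h₃, h₄⟩ := (Invariant.refl hs).exists_avoiding hx hE
      (hH.trans (Finset.filter_subset _ _))
    have i₂ := Invariant.of_reflTransGen hx hs h₂
    have hp : deg s (enemies x.color B) p = 0 := by
      have : deg s (enemies x.color B \ H) p + deg s H p = deg s (enemies x.color B) p :=
        Finset.sum_sdiff h₃
      rw [← this, hdeg, add_zero]
      exact deg_eq_zero_of_forall_not_adj fun m hm =>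
        h₄ m (Finset.mem_sdiff.1 hm).1 (Finset.mem_sdiff.1 hm).2
    have hpt : p = t := by
      by_contra hne
      have h₅ := i₂.parity p
      rw [← i₁.parity, hp, he'] at h₅
      simp [deg, hne] at h₅
    subst hpt
    have hend : ¬ CanJump B p := by
      rintro ⟨x', q, B', hj⟩
      obtain ⟨d, m, hgo, hsh, -, hme, -, hp', -⟩ := hj.effect
      obtain rfl : x' = x := by
        rw [i₂.king] at hp'
        exact (Option.some_inj.1 hp').symm
      have hpm := hsh.adj hgo.cases
      by_cases hmH : m ∈ H
      · exact (Finset.mem_filter.1 (hH hmH)).2 hpm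
      · exact h₄ m hme hmH hpm
    have := hall B (captureMove_iff.2 ⟨p, captureTo_of_reflTransGen hx h₂ hm.canJump hend⟩)
    have h₆ := h₃ heH
    simp [this] at h₆

end Checkers

/-! ### Certificates for capturing moves -/

namespace Checkers

variable {n : ℕ}

/-- A capturing move of the piece `x`, written down as the boards `B i` between its jumps, together
with the squares `p`, given by `P i p`, on which `x` stands at that time: from each of these
situations some jump leads to another one, or it completes the move, with the board `b'` and `x` on
the square `t`. The order of the situations need not be written down, since the number
of enemies on the board decreases. -/
def IsTrail (x : Piece) (t : Square n) (b' : Board n) (B : Square n → Board n)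
    (P : Square n → Square n → Prop) : Prop :=
  ∀ i p, P i p →
    (Jump (B i) p x t b' ∧ (Crowned x t ∨ ¬ CanJump b' t)) ∨
      ∃ q j, Jump (B i) p x q (B j) ∧ ¬ Crowned x q ∧ P j q

theorem IsTrail.captureTo {x : Piece} {t : Square n} {b' : Board n} {B : Square n → Board n}
    {P : Square n → Square n → Prop} (h : IsTrail x t b' B P) {i p : Square n} (hp : P i p) :
    CaptureTo (B i) p x t b' := by
  induction hk : (enemies x.color (B i)).card using Nat.strong_induction_on generalizing i p with
  | _ k ih =>
    rcases h i p hp with ⟨hj, hl⟩ | ⟨q, j, hj, hc, hq⟩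
    · exact .last hj hl
    · exact .more hj hc (ih _ (hk ▸ hj.card_enemies_lt) hq rfl)

/-- The situations of a capturing move are numbered by the piece that is captured next. -/
theorem CaptureTo.exists_isTrail {b b' : Board n} {s t : Square n} {x : Piece}
    (h : CaptureTo b s x t b') :
    ∃ (B : Square n → Board n) (P : Square n → Square n → Prop) (i : Square n),
      B i = b ∧ P i s ∧ IsTrail x t b' B P ∧ ∀ i p, P i p → i ∈ enemies x.color b := by
  induction h with
  | @last b s x t b' hj hl =>
    obtain ⟨-, m, -, -, -, hm, -⟩ := hj.effect
    refine ⟨fun _ => b, fun i p => i = m ∧ p = s, m, rfl, ⟨rfl, rfl⟩, ?_, ?_⟩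
    · rintro _ _ ⟨rfl, rfl⟩
      exact .inl ⟨hj, hl⟩
    · rintro _ _ ⟨rfl, rfl⟩
      exact hm
  | @more b s x q t b₁ b' hj hc _ ih =>
    obtain ⟨-, m, -, -, -, hm, -, -, -, -, -, -, he⟩ := hj.effect
    obtain ⟨B, P, j, hB, hP, hT, hi⟩ := ih
    have hne : ∀ i p, P i p → i ≠ m := by
      rintro i p h rfl
      have := hi i p h
      simp [he] at this
    refine ⟨Function.update B m b, Function.update P m (· = s), m, by simp, by simp, ?_, ?_⟩
    · intro i p hp
      by_cases him : i = m
      · subst him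
        simp only [Function.update_self] at hp
        subst hp
        refine .inr ⟨q, j, ?_, hc, ?_⟩
        · simp [hne j q hP, hB, hj]
        · simpa [hne j q hP] using hP
      · rw [Function.update_of_ne him] at hp ⊢
        rcases hT i p hp with h | ⟨q', j', h₁, h₂, h₃⟩
        · exact .inl h
        · refine .inr ⟨q', j', ?_, h₂, ?_⟩
          · rwa [Function.update_of_ne (hne j' q' h₃)]
          · rwa [Function.update_of_ne (hne j' q' h₃)]
    · intro i p hp
      by_cases him : i = m
      · exact him ▸ hm
      · rw [Function.update_of_ne him] at hp
        have := hi i p hp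
        rw [he] at this
        exact Finset.mem_of_mem_erase this

/-! ### Positions in which Red must win -/

/-- After a move, the player who made it has a piece on the board. -/
theorem LegalMove.not_noPieces {c : Color} {b b' : Board n} (h : LegalMove c b b') :
    ¬ NoPieces c b' := by
  rcases h with ⟨s, x, rfl, h⟩ | ⟨-, s, x, rfl, -, d, t, -, -, -, rfl⟩
  · obtain ⟨t, y, hy, hc⟩ := h.exists_piece
    exact fun h => h t y hy hc
  · exact fun h => h t (arrive x t) (by simp) (arrive_color x t)

/-- Red must win if and only if Red can capture and every capturing move takes all black pieces, since
an ordinary move leaves the black pieces on the board. For a man a single winning capturing move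
shows that every one wins; for a king the cuts are needed as well. -/
theorem forall_legalMove_red_iff {b : Board n} (hb : ¬ NoPieces .black b) :
    ((∃ b', LegalMove .red b b') ∧ ∀ b', LegalMove .red b b' → NoPieces .black b') ↔
      (∃ x : Piece, x.color = .red ∧ ∃ s, b s = some x ∧ CanJump b s) ∧
      ∀ x : Piece, x.color = .red → ∀ s, b s = some x → CanJump b s →
        ∃ t b', CaptureTo b s x t b' ∧ NoPieces .black b' ∧
          (x.king = true → ∀ e ∈ enemies .red b, ¬ Adj t e →
            ∃ φ, IsBridgeCut .red b s t e φ) := by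
  constructor
  · rintro ⟨⟨b₂, h₂⟩, hall⟩
    constructor
    · rcases h₂ with ⟨s, x, hx, h⟩ | ⟨hno, h⟩
      · exact ⟨x, hx, s, h.piece, h.canJump⟩
      · exfalso
        have hw := hall b₂ (.inr ⟨hno, h⟩)
        obtain ⟨s, x, hx, hs, d, t, -, -, ht, rfl⟩ := h
        refine hb fun u y hu hy => ?_
        have hut : u ≠ t := by
          rintro rfl
          simp [ht] at hu
        have hus : u ≠ s := by
          rintro rfl
          rw [hs] at hu
          rw [← Option.some_inj.1 hu, hx] at hy
          cases hy
        exact hw u y (by simp [hut, hus, hu]) hy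
    · intro x hx s hs hj
      obtain ⟨b', hb'⟩ := exists_captureMove hs hj
      obtain ⟨t, ht⟩ := captureMove_iff.1 hb'
      refine ⟨t, b', ht, hall b' (.inl ⟨s, x, hx, hb'⟩), fun hk e he hte => ?_⟩
      rw [← hx] at he ⊢
      refine exists_isBridgeCut hk ht (fun b'' h'' => ?_) he hte
      rw [hx, enemies_red_eq_empty]
      exact hall b'' (.inl ⟨s, x, hx, h''⟩)
  · rintro ⟨⟨x, hx, s, hs, hj⟩, hall⟩
    constructor
    · obtain ⟨b', hb'⟩ := exists_captureMove hs hj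
      exact ⟨b', .inl ⟨s, x, hx, hb'⟩⟩
    · rintro b'' (⟨s', x', hx', h''⟩ | ⟨hno, -⟩)
      · obtain ⟨t, b', h', hw, hφ⟩ := hall x' hx' s' h''.piece h''.canJump
        rw [← enemies_red_eq_empty, ← hx'] at hw ⊢
        cases hk : x'.king
        · rwa [(captureMove_iff.2 ⟨t, h'⟩).eq_of_man hk hw h'']
        · refine enemies_eq_empty_of_isBridgeCut hk h' hw ?_ h''
          rw [hx']
          exact hφ hk
      · exact (hno s x hs hx hj).elim

end Checkers

/-! ### Definability of the rules of the game -/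

namespace Checkers

open WordLogic

variable {J : Type} {d : ℕ}

section

variable {s t u : (F : Frame J) → (Fin d → Square F.n) → Square F.n}

namespace Def

theorem coord_succ {k : Coord} {f : ∀ {n : ℕ}, Square n → ℕ}
    (hk : ∀ {w} {T : Rels (Coord ⊕ J)} {F}, Represents w T F → ∀ s : Square F.n,
      f s < w.length ∧ ∀ x < w.length, (T (.inl k) (pos s) x x = true ↔ x = f s))
    (hs : IsVar s) (ht : IsVar t) : Def d fun F v => f (t F v) = f (s F v) + 1 := by
  obtain ⟨i, hi⟩ := hs
  obtain ⟨j, hj⟩ := ht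
  have hD : Definable d fun (w : List Symbol) (T : Rels (Coord ⊕ J)) v => ∃ x < w.length,
      T (.inl k) (v i) x x = true ∧ ∃ y < w.length, T (.inl k) (v j) y y = true ∧ y = x + 1 := by
    refine .ex (.and (.rel _ i.castSucc (.last _) (.last _)) (.ex (.and ?_ ?_)))
    · exact .rel _ j.castSucc.castSucc (.last _) (.last _)
    · exact .succ (Fin.last d).castSucc (.last _)
  refine of_definable hD fun w T F hF v => ?_
  rw [hi, hj]
  obtain ⟨h₁, h₁'⟩ := hk hF (v i)
  obtain ⟨h₂, h₂'⟩ := hk hF (v j)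
  constructor
  · rintro ⟨x, hx, hx', y, hy, hy', rfl⟩
    rw [← (h₁' x hx).1 hx', ← (h₂' _ hy).1 hy']
  · intro h
    exact ⟨_, h₁, (h₁' _ h₁).2 rfl, _, h₂, (h₂' _ h₂).2 rfl, h⟩

theorem coord_mod {k : Coord} {f : ∀ {n : ℕ}, Square n → ℕ}
    (hk : ∀ {w} {T : Rels (Coord ⊕ J)} {F}, Represents w T F → ∀ s : Square F.n,
      f s < w.length ∧ ∀ x < w.length, (T (.inl k) (pos s) x x = true ↔ x = f s))
    (hs : IsVar s) (a : Fin 4) : Def d fun F v => f (s F v) % 4 = a := by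
  obtain ⟨i, hi⟩ := hs
  have hD : Definable d fun (w : List Symbol) (T : Rels (Coord ⊕ J)) v => ∃ x < w.length,
      T (.inl k) (v i) x x = true ∧ (T (.inl .bit₀) x x x = true ↔ a.val % 2 = 1) ∧
      (T (.inl .bit₁) x x x = true ↔ 2 ≤ a.val) := by
    refine .ex (.and (.rel _ i.castSucc (.last _) (.last _)) (.and (.iff ?_ ?_) (.iff ?_ ?_)))
    · exact .rel _ (.last _) (.last _) (.last _)
    · exact .const _
    · exact .rel _ (.last _) (.last _) (.last _)
    · exact .const _
  refine of_definable hD fun w T F hF v => ?_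
  rw [hi]
  obtain ⟨h₁, h₁'⟩ := hk hF (v i)
  constructor
  · rintro ⟨x, hx, hx', h₂, h₃⟩
    rw [hF.bit₀ x hx, (h₁' x hx).1 hx'] at h₂
    rw [hF.bit₁ x hx, (h₁' x hx).1 hx'] at h₃
    omega
  · intro h
    refine ⟨_, h₁, (h₁' _ h₁).2 rfl, ?_, ?_⟩
    · rw [hF.bit₀ _ h₁]
      omega
    · rw [hF.bit₁ _ h₁]
      omega

theorem row_pos {w} {T : Rels (Coord ⊕ J)} {F} (h : Represents w T F) (s : Square F.n) :
    s.1.val < w.length ∧ ∀ x < w.length, (T (.inl .row) (pos s) x x = true ↔ x = s.1.val) := by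
  refine ⟨?_, fun x hx => ?_⟩
  · rw [h.length]
    exact s.1.2.trans_le (Nat.le_mul_of_pos_right _ (by omega))
  · rw [h.row _ (h.pos_lt s) x hx, pos_div]

theorem col_pos {w} {T : Rels (Coord ⊕ J)} {F} (h : Represents w T F) (s : Square F.n) :
    s.2.val < w.length ∧ ∀ x < w.length, (T (.inl .col) (pos s) x x = true ↔ x = s.2.val) := by
  refine ⟨?_, fun x hx => ?_⟩
  · rw [h.length]
    exact s.2.2.trans_le (Nat.le_mul_of_pos_right _ (by omega))
  · rw [h.col _ (h.pos_lt s) x hx, pos_mod]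

theorem row_succ (hs : IsVar s) (ht : IsVar t) :
    Def d fun F v => (t F v).1.val = (s F v).1.val + 1 :=
  coord_succ (f := fun s => s.1.val) row_pos hs ht

theorem col_succ (hs : IsVar s) (ht : IsVar t) :
    Def d fun F v => (t F v).2.val = (s F v).2.val + 1 :=
  coord_succ (f := fun s => s.2.val) col_pos hs ht

/-- Conditions on the residues modulo `4` of the coordinates of two squares are definable. -/
theorem residues (Q : ℕ → ℕ → ℕ → ℕ → Prop) (hs : IsVar s) (ht : IsVar t) :
    Def d fun F v => Q ((s F v).1.val % 4) ((s F v).2.val % 4) ((t F v).1.val % 4)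
      ((t F v).2.val % 4) := by
  refine congr (P := fun F v => ∃ a b c e : Fin 4, Q a b c e ∧ (s F v).1.val % 4 = a ∧
    (s F v).2.val % 4 = b ∧ (t F v).1.val % 4 = c ∧ (t F v).2.val % 4 = e) ?_ fun F v => ?_
  · exact .finite_ex fun a => .finite_ex fun b => .finite_ex fun c => .finite_ex fun e =>
      .and (.const _) <| .and (coord_mod (f := fun s => s.1.val) row_pos hs a) <| .and (coord_mod (f := fun s => s.2.val) col_pos hs b) <|
      .and (coord_mod (f := fun s => s.1.val) row_pos ht c) (coord_mod (f := fun s => s.2.val) col_pos ht e)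
  · constructor
    · rintro ⟨a, b, c, e, h, h₁, h₂, h₃, h₄⟩
      rwa [h₁, h₂, h₃, h₄]
    · exact fun h => ⟨⟨_, Nat.mod_lt _ (by omega)⟩, ⟨_, Nat.mod_lt _ (by omega)⟩,
        ⟨_, Nat.mod_lt _ (by omega)⟩, ⟨_, Nat.mod_lt _ (by omega)⟩, h, rfl, rfl, rfl, rfl⟩

theorem sameClass (hs : IsVar s) (ht : IsVar t) : Def d fun F v => SameClass (s F v) (t F v) :=
  (residues (fun a b c e => (c + a) % 2 = 0 ∧ (c + e + 3 * (a + b)) % 4 = 0) hs ht).congr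
    fun F v => by unfold SameClass; omega

theorem even (hs : IsVar s) : Def d fun F v => Even ((s F v).1.val + (s F v).2.val) :=
  (residues (fun a b _ _ => (a + b) % 2 = 0) hs hs).congr
    fun F v => by rw [Nat.even_iff]; omega

theorem adj (hs : IsVar s) (ht : IsVar t) : Def d fun F v => Adj (s F v) (t F v) :=
  .and (.or (row_succ hs ht) (row_succ ht hs)) (.or (col_succ hs ht) (col_succ ht hs))

end Def

/-- The diagonal directions, named by two signs. -/
def dir (e : Bool × Bool) : ℤ × ℤ := (if e.1 then 1 else -1, if e.2 then 1 else -1)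

theorem exists_dir {e : ℤ × ℤ} (h : (e.1 = 1 ∨ e.1 = -1) ∧ (e.2 = 1 ∨ e.2 = -1)) :
    ∃ f, dir f = e := by
  obtain ⟨a, b⟩ := e
  obtain ⟨rfl | rfl, rfl | rfl⟩ := h
  exacts [⟨(true, true), rfl⟩, ⟨(true, false), rfl⟩, ⟨(false, true), rfl⟩, ⟨(false, false), rfl⟩]

theorem Def.isShift (e : Bool × Bool) (hs : IsVar s) (ht : IsVar t) :
    Def d fun F v => IsShift (s F v) 1 (dir e) (t F v) := by
  obtain ⟨_ | _, _ | _⟩ := e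
  · exact (Def.and (row_succ ht hs) (col_succ ht hs)).congr fun F v => by
      simp only [IsShift, dir]; norm_num; omega
  · exact (Def.and (row_succ ht hs) (col_succ hs ht)).congr fun F v => by
      simp only [IsShift, dir]; norm_num; omega
  · exact (Def.and (row_succ hs ht) (col_succ ht hs)).congr fun F v => by
      simp only [IsShift, dir]; norm_num; omega
  · exact (Def.and (row_succ hs ht) (col_succ hs ht)).congr fun F v => by
      simp only [IsShift, dir]; norm_num; omega

theorem Def.crowned (x : Piece) (ht : IsVar t) : Def d fun F v => Crowned x (t F v) := by
  refine .and (.const _) ?_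
  cases x.color
  · refine (Def.all (R := fun F v u => ¬ u.1.val = (t F v).1.val + 1)
      (.not (row_succ ht.init .last))).congr fun F v => ⟨fun h => ?_, fun h u hu => ?_⟩
    · by_contra hne
      simp only [Color.IsLastRow] at hne
      exact h (⟨(t F v).1.val + 1, by omega⟩, (t F v).2) rfl
    · have := u.1.2
      simp only [Color.IsLastRow] at h
      omega
  · refine (Def.all (R := fun F v u => ¬ (t F v).1.val = u.1.val + 1)
      (.not (row_succ .last ht.init))).congr fun F v => ⟨fun h => ?_, fun h u hu => ?_⟩
    · by_contra hne
      simp only [Color.IsLastRow] at hne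
      exact h (⟨(t F v).1.val - 1, by omega⟩, (t F v).2) (by simp; omega)
    · simp only [Color.IsLastRow] at h
      omega

/-- A board that depends on the values of variables is definable if its entries are. -/
def DefB {J : Type} (d : ℕ) (β : (F : Frame J) → (Fin d → Square F.n) → Board F.n) : Prop :=
  ∀ y, Def (d + 1) fun F v => β F (Fin.init v) (v (Fin.last d)) = y

variable {β β' : (F : Frame J) → (Fin d → Square F.n) → Board F.n}

namespace DefB

theorem at_eq (hβ : DefB d β) (ht : IsVar t) (y : Option Piece) :
    Def d fun F v => β F v (t F v) = y := by
  obtain ⟨i, hi⟩ := ht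
  refine ((hβ y).rename (Fin.snoc (α := fun _ => Fin d) id i)).congr fun F v => ?_
  have : Fin.init (v ∘ Fin.snoc (α := fun _ => Fin d) id i) = v := by
    funext j
    simp [Fin.init]
  rw [this, hi]
  simp

theorem init (hβ : DefB d β) : DefB (d + 1) fun F v => β F (Fin.init v) := by
  intro y
  refine ((hβ y).rename (Fin.snoc (α := fun _ => Fin (d + 2))
    (fun i => i.castSucc.castSucc) (Fin.last _))).congr fun F v => ?_
  have : Fin.init (v ∘ Fin.snoc (α := fun _ => Fin (d + 2))
    (fun i : Fin d => i.castSucc.castSucc) (Fin.last _)) = Fin.init (Fin.init v) := by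
    funext j
    simp [Fin.init]
  rw [this]
  simp

theorem start : DefB d fun (F : Frame J) _ => F.b := fun _ => .board _ .last

theorem eq (hβ : DefB d β) (hβ' : DefB d β') : Def d fun F v => β F v = β' F v :=
  (Def.all (R := fun F v u => ∃ y, β F v u = y ∧ β' F v u = y)
    (.finite_ex fun y => .and (hβ y) (hβ' y))).congr fun F v => by
      simp [funext_iff, eq_comm]

theorem mem_enemies (hβ : DefB d β) (ht : IsVar t) (c : Color) :
    Def d fun F v => t F v ∈ enemies c (β F v) :=
  (Def.finite_ex (R := fun (y : Piece) F v => β F v (t F v) = some y ∧ y.color ≠ c)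
    fun _ => .and (hβ.at_eq ht _) (.const _)).congr fun _ _ => Checkers.mem_enemies.symm

theorem noPieces (hβ : DefB d β) (c : Color) : Def d fun F v => NoPieces c (β F v) :=
  .all (.finite_all fun _ => .imp (hβ _) (.const _))

end DefB

theorem jump_iff {n : ℕ} {b b' : Board n} {s t : Square n} {x : Piece} :
    Jump b s x t b' ↔ b s = some x ∧ b t = none ∧ ∃ e, x.MayGo (dir e) ∧
      ∃ m, IsShift s 1 (dir e) m ∧ IsShift m 1 (dir e) t ∧ m ∈ enemies x.color b ∧
        b' s = none ∧ b' m = none ∧ (Crowned x t → b' t = some ⟨x.color, true⟩) ∧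
        (¬ Crowned x t → b' t = some x) ∧
        ∀ u, ¬ u = s → ¬ u = m → ¬ u = t → ∃ y, b' u = y ∧ b u = y := by
  have hshift : ∀ {e : ℤ × ℤ} {m : Square n}, IsShift s 1 e m →
      (IsShift s 2 e t ↔ IsShift m 1 e t) := by
    rintro e m ⟨h₁, h₂⟩
    unfold IsShift
    omega
  constructor
  · intro h
    obtain ⟨e, m, hgo, hm, ht, hme, hbt, hbs, hb't, hb'm, hb's, hrest, -⟩ := h.effect
    obtain ⟨e, rfl⟩ := exists_dir hgo.cases
    refine ⟨hbs, hbt, e, hgo, m, hm, (hshift hm).1 ht, hme, hb's, hb'm, fun hc => ?_,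
      fun hc => ?_, fun u h₁ h₂ h₃ => ⟨_, hrest u h₁ h₂ h₃, rfl⟩⟩
    · rw [hb't, arrive, if_pos hc]
    · rw [hb't, arrive_of_not_crowned hc]
  · rintro ⟨hbs, hbt, e, hgo, m, hm, ht, hme, hb's, hb'm, h₁, h₂, hrest⟩
    obtain ⟨y, hy, hc⟩ := mem_enemies.1 hme
    have hmt : m ≠ t := by
      rintro rfl
      simp [hbt] at hy
    have hst : s ≠ t := by
      rintro rfl
      simp [hbt] at hbs
    refine ⟨hbs, dir e, m, y, hgo, hm, (hshift hm).2 ht, hy, hc, hbt, ?_⟩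
    funext u
    by_cases hut : u = t
    · rw [hut, Function.update_self]
      by_cases hct : Crowned x t
      · rw [h₁ hct, arrive, if_pos hct]
      · rw [h₂ hct, arrive_of_not_crowned hct]
    rw [Function.update_of_ne hut]
    by_cases hum : u = m
    · rw [hum, Function.update_self, hb'm]
    rw [Function.update_of_ne hum]
    by_cases hus : u = s
    · rw [hus, Function.update_self, hb's]
    rw [Function.update_of_ne hus]
    obtain ⟨z, hz, hz'⟩ := hrest u hus hum hut
    rw [hz, hz']

theorem canJump_iff {n : ℕ} {b : Board n} {s : Square n} :
    CanJump b s ↔ ∃ x : Piece, b s = some x ∧ ∃ e, x.MayGo (dir e) ∧ ∃ t, b t = none ∧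
      ∃ m, IsShift s 1 (dir e) m ∧ IsShift m 1 (dir e) t ∧ m ∈ enemies x.color b := by
  constructor
  · rintro ⟨x, t, b', h⟩
    obtain ⟨h₁, h₂, e, h₃, m, h₄, h₅, h₆, -⟩ := jump_iff.1 h
    exact ⟨x, h₁, e, h₃, t, h₂, m, h₄, h₅, h₆⟩
  · rintro ⟨x, h₁, e, h₃, t, h₂, m, h₄, h₅, h₆⟩
    have : IsShift s 2 (dir e) t := by
      obtain ⟨a₁, a₂⟩ := h₄
      obtain ⟨a₃, a₄⟩ := h₅
      constructor <;> omega
    obtain ⟨b', h, -⟩ := exists_jump h₁ h₃ h₄ this h₆ h₂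
    exact ⟨x, t, b', h⟩

theorem slide_iff {n : ℕ} {b b' : Board n} {s : Square n} {x : Piece} :
    Slide b s x b' ↔ b s = some x ∧ ∃ e, x.MayGo (dir e) ∧
      ∃ t, IsShift s 1 (dir e) t ∧ b t = none ∧
        b' s = none ∧ (Crowned x t → b' t = some ⟨x.color, true⟩) ∧
        (¬ Crowned x t → b' t = some x) ∧
        ∀ u, ¬ u = s → ¬ u = t → ∃ y, b' u = y ∧ b u = y := by
  constructor
  · rintro ⟨hbs, e, t, hgo, ht, hbt, rfl⟩
    obtain ⟨e, rfl⟩ := exists_dir hgo.cases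
    have hst : s ≠ t := by
      rintro rfl
      simp [hbt] at hbs
    refine ⟨hbs, e, hgo, t, ht, hbt, by simp [hst], fun hc => ?_, fun hc => ?_,
      fun u h₁ h₂ => ⟨_, by simp [h₁, h₂], rfl⟩⟩
    · rw [Function.update_self, arrive, if_pos hc]
    · rw [Function.update_self, arrive_of_not_crowned hc]
  · rintro ⟨hbs, e, hgo, t, ht, hbt, hb's, h₁, h₂, hrest⟩
    refine ⟨hbs, dir e, t, hgo, ht, hbt, ?_⟩
    funext u
    by_cases hut : u = t
    · rw [hut, Function.update_self]
      by_cases hct : Crowned x t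
      · rw [h₁ hct, arrive, if_pos hct]
      · rw [h₂ hct, arrive_of_not_crowned hct]
    rw [Function.update_of_ne hut]
    by_cases hus : u = s
    · rw [hus, Function.update_self, hb's]
    rw [Function.update_of_ne hus]
    obtain ⟨z, hz, hz'⟩ := hrest u hus hut
    rw [hz, hz']

theorem Def.jump (x : Piece) (hβ : DefB d β) (hs : IsVar s) (ht : IsVar t) (hβ' : DefB d β') :
    Def d fun F v => Jump (β F v) (s F v) x (t F v) (β' F v) := by
  simp only [jump_iff]
  exact .and (hβ.at_eq hs _) <| .and (hβ.at_eq ht _) <| .finite_ex fun e => .and (.const _) <|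
    .ex <| .and (.isShift e hs.init .last) <| .and (.isShift e .last ht.init) <|
    .and (hβ.init.mem_enemies .last _) <| .and (hβ'.init.at_eq hs.init _) <|
    .and (hβ'.init.at_eq .last _) <|
    .and (.imp (.crowned x ht.init) (hβ'.init.at_eq ht.init _)) <|
    .and (.imp (.not (.crowned x ht.init)) (hβ'.init.at_eq ht.init _)) <|
    .all <| .imp (.not (.eq .last hs.init.init)) <| .imp (.not (.eq .last IsVar.last.init)) <|
    .imp (.not (.eq .last ht.init.init)) <| .finite_ex fun y =>
    .and (hβ'.init y) (hβ.init y)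

theorem Def.canJump (hβ : DefB d β) (hs : IsVar s) :
    Def d fun F v => CanJump (β F v) (s F v) := by
  simp only [canJump_iff]
  exact .finite_ex fun x => .and (hβ.at_eq hs _) <| .finite_ex fun e => .and (.const _) <|
    .ex <| .and (hβ none) <| .ex <| .and (.isShift e hs.init.init .last) <|
    .and (.isShift e .last IsVar.last.init) (hβ.init.init.mem_enemies .last _)

theorem Def.slide (x : Piece) (hβ : DefB d β) (hs : IsVar s) (hβ' : DefB d β') :
    Def d fun F v => Slide (β F v) (s F v) x (β' F v) := by
  simp only [slide_iff]
  exact .and (hβ.at_eq hs _) <| .finite_ex fun e => .and (.const _) <|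
    .ex <| .and (.isShift e hs.init .last) <| .and (hβ none) <|
    .and (hβ'.init.at_eq hs.init _) <|
    .and (.imp (.crowned x .last) (hβ' _)) <| .and (.imp (.not (.crowned x .last)) (hβ' _)) <|
    .all <| .imp (.not (.eq .last hs.init.init)) <| .imp (.not (.eq .last IsVar.last.init)) <|
    .finite_ex fun y => .and (hβ'.init y) (hβ.init y)

end

end Checkers

/-! ### The certificate as a first-order condition -/

namespace Checkers

open WordLogic

/-- The names of the relations that make up a certificate. A board is written down by three
relations, one for each binary digit in the code of the contents of a square. A certificate consists
of the boards between the jumps of a capturing move (`mid`), the squares on which the moving piece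
stands at that time (`occ`), the boards at the end of Red's capturing moves (`fin`), the board after
Black's move (`next`), and the cuts for the capturing moves of red kings (`cut`). -/
inductive Table
  | mid (c : Color) (k : Fin 3)
  | occ (c : Color)
  | fin (k : Fin 3)
  | next (k : Fin 3)
  | cut
  deriving Fintype

/-- The contents of a square, from three binary digits. -/
def decodeSquare (r : Fin 3 → Bool) : Option Piece :=
  if r 0 then some ⟨if r 1 then .black else .red, r 2⟩ else none

theorem decodeSquare_surjective : Function.Surjective decodeSquare := by
  rintro (_ | ⟨_ | _, k⟩)
  · exact ⟨fun _ => false, rfl⟩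
  · exact ⟨![true, true, k], rfl⟩
  · exact ⟨![true, false, k], rfl⟩

namespace Frame

variable (F : Frame Table)

/-- The board numbered `i` in the description of the capturing move of a piece of `c` from `s`. -/
def mid (c : Color) (s i : Square F.n) : Board F.n :=
  fun u => decodeSquare fun k => F.R (.mid c k) s i u

/-- The board at the end of the capturing move of Red from `s`. -/
def fin (s : Square F.n) : Board F.n :=
  fun u => decodeSquare fun k => F.R (.fin k) s s u

/-- The board after Black's move. -/
def next : Board F.n :=
  fun u => decodeSquare fun k => F.R (.next k) u u u

/-- The relations of the frame describe a capturing move from `s` to `t`. -/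
def Captures (c : Color) (b : Board F.n) (s : Square F.n) (x : Piece) (t : Square F.n)
    (b' : Board F.n) : Prop :=
  ∃ i, F.mid c s i = b ∧ F.R (.occ c) s i s = true ∧
    IsTrail x t b' (F.mid c s) fun i p => F.R (.occ c) s i p = true

/-- The relations of the frame describe a legal move of Black. -/
def BlackMoves : Prop :=
  (∃ x : Piece, x.color = .black ∧ ∃ s t, F.Captures .black F.b s x t F.next) ∨
    (∀ x : Piece, x.color = .black → ∀ s, F.b s = some x → ¬ CanJump F.b s) ∧
      ∃ x : Piece, x.color = .black ∧ ∃ s, Slide F.b s x F.next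

/-- The relations of the frame show that Red must win after Black's move. -/
def RedMustWin : Prop :=
  (∃ x : Piece, x.color = .red ∧ ∃ s, F.next s = some x ∧ CanJump F.next s) ∧
    ∀ x : Piece, x.color = .red → ∀ s, F.next s = some x → CanJump F.next s →
      ∃ t, F.Captures .red F.next s x t (F.fin s) ∧ NoPieces .black (F.fin s) ∧
        (x.king = true → ∀ e, e ∈ enemies .red F.next → ¬ Adj t e →
          IsBridgeCut .red F.next s t e fun u => F.R .cut s e u)

/-- The relations of the frame certify that its board is in the language. -/
def Certifies : Prop := IsConfiguration F.b ∧ F.BlackMoves ∧ F.RedMustWin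

variable {F}

theorem Captures.captureTo {c : Color} {b b' : Board F.n} {s t : Square F.n} {x : Piece}
    (h : F.Captures c b s x t b') : CaptureTo b s x t b' := by
  obtain ⟨i, rfl, hi, h⟩ := h
  exact h.captureTo hi

theorem Certifies.loseInOne (h : F.Certifies) : LoseInOne F.b := by
  obtain ⟨-, hb, hr, hr'⟩ := h
  have hmove : LegalMove .black F.b F.next := by
    rcases hb with ⟨x, hx, s, t, h⟩ | ⟨hno, x, hx, s, h⟩
    · exact .inl ⟨s, x, hx, captureMove_iff.2 ⟨t, h.captureTo⟩⟩
    · exact .inr ⟨fun s x hs hx => hno x hx s hs, s, x, hx, h⟩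
  refine ⟨F.next, hmove, (forall_legalMove_red_iff hmove.not_noPieces).2 ⟨hr, ?_⟩⟩
  intro x hx s hs hj
  obtain ⟨t, h, hw, hφ⟩ := hr' x hx s hs hj
  exact ⟨t, F.fin s, h.captureTo, hw, fun hk e he hte => ⟨_, hφ hk e he hte⟩⟩

end Frame

theorem exists_certifies {n : ℕ} {b : Board n} (hb : IsConfiguration b) (h : LoseInOne b) :
    ∃ R, (Frame.mk n b R : Frame Table).Certifies := by
  classical
  obtain ⟨b₁, hmove, hred⟩ := h
  rw [forall_legalMove_red_iff hmove.not_noPieces] at hred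
  obtain ⟨hr, hr'⟩ := hred
  -- the description of Black's move, which is vacuous if this is not a capturing move
  obtain ⟨B₀, P₀, hblack⟩ : ∃ (B₀ : Square n → Board n) (P₀ : Square n → Square n → Prop),
      (∃ x : Piece, x.color = .black ∧ ∃ s t, ∃ i, B₀ i = b ∧ P₀ i s ∧ IsTrail x t b₁ B₀ P₀) ∨
        (∀ x : Piece, x.color = .black → ∀ s, b s = some x → ¬ CanJump b s) ∧
          ∃ x : Piece, x.color = .black ∧ ∃ s, Slide b s x b₁ := by
    rcases hmove with ⟨s, x, hx, h⟩ | ⟨hno, s, x, hx, h⟩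
    · obtain ⟨t, h⟩ := captureMove_iff.1 h
      obtain ⟨B, P, i, hB, hP, hT, -⟩ := h.exists_isTrail
      exact ⟨B, P, .inl ⟨x, hx, s, t, i, hB, hP, hT⟩⟩
    · exact ⟨fun _ => b, fun _ _ => False,
        .inr ⟨fun x hx s hs => hno s x hs hx, x, hx, s, h⟩⟩
  -- the description of a capturing move of Red from `s`, if there is one
  have hs : ∀ s, ∃ (B : Square n → Board n) (P : Square n → Square n → Prop) (b' : Board n)
      (φ : Square n → Square n → Bool), ∀ x : Piece, x.color = .red → b₁ s = some x →
        CanJump b₁ s → ∃ t, (∃ i, B i = b₁ ∧ P i s ∧ IsTrail x t b' B P) ∧ NoPieces .black b' ∧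
          (x.king = true → ∀ e, e ∈ enemies .red b₁ → ¬ Adj t e →
            IsBridgeCut .red b₁ s t e (φ e)) := by
    intro s
    by_cases hx : ∃ x : Piece, x.color = .red ∧ b₁ s = some x ∧ CanJump b₁ s
    · obtain ⟨x, hx, hs, hj⟩ := hx
      obtain ⟨t, b', h, hw, hφ⟩ := hr' x hx s hs hj
      obtain ⟨B, P, i, hB, hP, hT, -⟩ := h.exists_isTrail
      have hφ' : ∀ e, ∃ φ, x.king = true → e ∈ enemies .red b₁ → ¬ Adj t e →
          IsBridgeCut .red b₁ s t e φ := by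
        intro e
        by_cases he : x.king = true ∧ e ∈ enemies .red b₁ ∧ ¬ Adj t e
        · obtain ⟨φ, hφ⟩ := hφ he.1 e he.2.1 he.2.2
          exact ⟨φ, fun _ _ _ => hφ⟩
        · exact ⟨fun _ => true, fun h₁ h₂ h₃ => (he ⟨h₁, h₂, h₃⟩).elim⟩
      choose φ hφ' using hφ'
      refine ⟨B, P, b', φ, fun x' _ hs' _ => ?_⟩
      obtain rfl : x = x' := Option.some_inj.1 (hs.symm.trans hs')
      exact ⟨t, ⟨i, hB, hP, hT⟩, hw, fun hk e => hφ' e hk⟩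
    · exact ⟨fun _ => b, fun _ _ => False, b, fun _ _ => true,
        fun x h₁ h₂ h₃ => (hx ⟨x, h₁, h₂, h₃⟩).elim⟩
  choose B P b' φ hs using hs
  obtain ⟨enc, henc⟩ := decodeSquare_surjective.hasRightInverse
  let R : Table → Square n → Square n → Square n → Bool := fun j s i u => match j with
    | .mid .black k => enc (B₀ i u) k
    | .mid .red k => enc (B s i u) k
    | .occ .black => decide (P₀ i u)
    | .occ .red => decide (P s i u)
    | .fin k => enc (b' s u) k
    | .next k => enc (b₁ u) k
    | .cut => φ s i u
  refine ⟨R, hb, ?_⟩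
  have h₁ : (Frame.mk n b R).next = b₁ := by
    funext u
    exact henc _
  have h₂ : (Frame.mk n b R).fin = b' := by
    funext s u
    exact henc _
  have h₃ : (Frame.mk n b R).mid .black = fun _ => B₀ := by
    funext s i u
    exact henc _
  have h₄ : (Frame.mk n b R).mid .red = B := by
    funext s i u
    exact henc _
  unfold Frame.BlackMoves Frame.RedMustWin Frame.Captures
  rw [h₁, h₂, h₃, h₄]
  simp only [R, decide_eq_true_eq]
  exact ⟨hblack, hr, fun x hx s hx' hj => hs s x hx hx' hj⟩

section

variable {d : ℕ} {s t i : (F : Frame Table) → (Fin d → Square F.n) → Square F.n}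
  {β β' : (F : Frame Table) → (Fin d → Square F.n) → Board F.n}

theorem Def.bool_eq {f g : (F : Frame Table) → (Fin d → Square F.n) → Bool}
    (hf : Def d fun F v => f F v = true) (hg : Def d fun F v => g F v = true) :
    Def d fun F v => f F v = g F v :=
  (hf.iff hg).congr fun _ _ => Bool.eq_iff_iff.symm

theorem DefB.decodeSquare {ρ : Fin 3 → (F : Frame Table) → (Fin d → Square F.n) → Square F.n → Bool}
    (h : ∀ k, Def (d + 1) fun F v => ρ k F (Fin.init v) (v (Fin.last d)) = true) :
    DefB d fun F v u => Checkers.decodeSquare fun k => ρ k F v u := by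
  intro y
  refine (Def.finite_ex (R := fun (r : Fin 3 → Bool) F v => Checkers.decodeSquare r = y ∧
    ∀ k, (ρ k F (Fin.init v) (v (Fin.last d)) = true ↔ r k = true)) fun r =>
      .and (.const _) (.finite_all fun k => .iff (h k) (.const _))).congr fun F v => ?_
  simp only [← Bool.eq_iff_iff]
  constructor
  · rintro ⟨r, rfl, h⟩
    simp only [h]
  · exact fun h => ⟨_, h, fun _ => rfl⟩

theorem DefB.mid (c : Color) (hs : IsVar s) (hi : IsVar i) :
    DefB d fun F v => F.mid c (s F v) (i F v) :=
  .decodeSquare fun _ => .rel _ hs.init hi.init .last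

theorem DefB.fin (hs : IsVar s) : DefB d fun F v => F.fin (s F v) :=
  .decodeSquare fun _ => .rel _ hs.init hs.init .last

theorem DefB.next : DefB d fun (F : Frame Table) _ => F.next :=
  .decodeSquare fun _ => .rel _ .last .last .last

theorem Def.captures (c : Color) (x : Piece) (hβ : DefB d β) (hs : IsVar s) (ht : IsVar t)
    (hβ' : DefB d β') :
    Def d fun F v => F.Captures c (β F v) (s F v) x (t F v) (β' F v) := by
  unfold Frame.Captures IsTrail
  refine .ex <| .and (DefB.eq (.mid c hs.init .last) hβ.init) <| .and (.rel _ hs.init .last hs.init) <|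
    .all <| .all <| .imp (.rel _ hs.init.init.init IsVar.last.init .last) <| .or ?_ ?_
  · exact .and (.jump x (.mid c hs.init.init.init IsVar.last.init) .last ht.init.init.init
      hβ'.init.init.init) <| .or (.crowned x ht.init.init.init) <|
      .not (.canJump hβ'.init.init.init ht.init.init.init)
  · exact .ex <| .ex <| .and (.jump x
        (.mid c hs.init.init.init.init.init IsVar.last.init.init.init) IsVar.last.init.init
        IsVar.last.init (.mid c hs.init.init.init.init.init .last)) <|
      .and (.not (.crowned x IsVar.last.init)) <|
      .rel _ hs.init.init.init.init.init .last IsVar.last.init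

theorem Def.blackMoves : Def d fun F _ => F.BlackMoves := by
  unfold Frame.BlackMoves
  exact .or
    (.finite_ex fun x => .and (.const _) <| .ex <| .ex <|
      .captures .black x .start IsVar.last.init .last .next)
    (.and
      (.finite_all fun x => .imp (.const _) <| .all <| .imp (.board _ .last) <|
        .not (.canJump .start .last))
      (.finite_ex fun x => .and (.const _) <| .ex <| .slide x .start .last .next))

theorem Def.redMustWin : Def d fun F _ => F.RedMustWin := by
  unfold Frame.RedMustWin IsBridgeCut
  refine .and
    (.finite_ex fun x => .and (.const _) <| .ex <| .and (DefB.next.at_eq .last _) <|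
      .canJump .next .last)
    (.finite_all fun x => .imp (.const _) <| .all <| .imp (DefB.next.at_eq .last _) <|
      .imp (.canJump .next .last) <| .ex <|
      .and (.captures .red x .next IsVar.last.init .last (.fin IsVar.last.init)) <|
      .and ((DefB.fin IsVar.last.init).noPieces .black) <| .imp (.const _) <|
      .all <| .imp (DefB.next.mem_enemies .last _) <| .imp (.not (.adj IsVar.last.init .last)) <|
      .all <| .imp (DefB.next.mem_enemies .last _) <|
      .imp (.not (.adj IsVar.last.init.init .last)) <|
      .all <| .all <| .imp (.sameClass IsVar.last.init.init.init.init.init IsVar.last.init) <|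
      .imp (.sameClass IsVar.last.init.init.init.init.init .last) <|
      .imp (.adj IsVar.last.init IsVar.last.init.init) <|
      .imp (.adj .last IsVar.last.init.init) <| .imp (.not (.eq IsVar.last.init .last)) <| ?_)
  exact .iff
    (.bool_eq
      (.rel _ IsVar.last.init.init.init.init.init IsVar.last.init.init.init IsVar.last.init)
      (.rel _ IsVar.last.init.init.init.init.init IsVar.last.init.init.init .last))
    (.not (.eq IsVar.last.init.init IsVar.last.init.init.init))

theorem Def.certifies : Def d fun F _ => F.Certifies := by
  unfold Frame.Certifies IsConfiguration
  exact .and (.all <| .imp (.not (.board none .last)) (.even .last)) (.and .blackMoves .redMustWin)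

end

end Checkers

theorem theorem3 : Checkers.loseInOneCheckers ∈ Complexity.NP Checkers.Symbol := by
  obtain ⟨φ, hφ⟩ := Checkers.definable_format (J := Checkers.Table)
  obtain ⟨ψ, hψ⟩ := Checkers.Def.certifies (d := 0)
  have hψ' : ∀ w T F, Checkers.Represents w T F → (ψ.Holds w T Fin.elim0 ↔ F.Certifies) := by
    intro w T F hF
    have h := hψ w T F hF Fin.elim0
    rwa [Subsingleton.elim (fun i : Fin 0 => Checkers.pos (Fin.elim0 i : Checkers.Square F.n))
      Fin.elim0] at h
  refine WordLogic.mem_NP_of_fml (.and φ ψ) fun w => ⟨?_, ?_⟩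
  · rintro ⟨n, b, hb, h, rfl⟩
    obtain ⟨R, hR⟩ := Checkers.exists_certifies hb h
    obtain ⟨T, hT⟩ := Checkers.exists_represents ⟨n, b, R⟩
    have hn : 0 < n := by
      obtain ⟨b₁, hmove, -⟩ := h
      by_contra hn
      exact hmove.not_noPieces fun s => (hn s.1.pos).elim
    exact ⟨T, (hφ _ _ _ fun i => i.elim0).2 (hT.format hn), (hψ' _ _ _ hT).2 hR⟩
  · rintro ⟨T, h₁, h₂⟩
    obtain ⟨F, hF⟩ := ((hφ w T _ fun i => i.elim0).1 h₁).represents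
    have hc := (hψ' _ _ _ hF).1 h₂
    exact ⟨F.n, F.b, hc.1, hc.loseInOne, hF.word⟩
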